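/- Theorem. Let $K$ be an algebraically closed field of characteristic zero, let $E$ be a finite group, and let $M=(V,\rho)$ be a finite-dimensional $KE$-module with character $\chi=\sum_{\mu} f_\mu\,\mu$, where $\mu$ runs over the set $\mathrm{Irr}_K(E)$ of irreducible $K$-characters of $E$ and $f_\mu\in\mathbb{Z}_{\ge 0}$. For $1\le t\le \dim_K V$ let $\mathrm{Gr}(t,M)$ be the set of $t$-dimensional $KE$-submodules of $M$, regarded as a subset of the Grassmannian $\mathrm{Gr}(t,V)\subseteq\mathbb{P}(\bigwedge^t V)$ with the induced variety structure, and let $C_\chi(t)$ be the set of $K$-characters $\eta=\sum_\mu e_\mu\,\mu$ of $E$ of degree $\eta(1)=t$ with $0\le e_\mu\le f_\mu$ for all $\mu$. For $\eta\in C_\chi(t)$ let $\mathrm{Gr}(\eta,M)\subseteq \mathrm{Gr}(t,M)$ be the set of submodules with character $\eta$. For characters $\varphi=\sum_\mu a_\mu\mu$ and $\psi=\sum_\mu b_\mu\mu$ write $\langle\varphi,\psi\rangle=\sum_\mu a_\mu b_\mu$. Then: (1) For every $\eta=\sum_\mu e_\mu\mu\in C_\chi(t)$, the set $\mathrm{Gr}(\eta,M)$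 is a rational subvariety of $\mathrm{Gr}(t,M)$: it is Zariski closed in $\mathrm{Gr}(t,M)$ and in $\mathbb{P}(\bigwedge^t V)$, irreducible, and birational to an affine space. With its induced structure it is isomorphic, as a variety, to the product of Grassmannians $\prod_{\mu,\ e_\mu\neq 0}\mathrm{Gr}(e_\mu,f_\mu)$, where $\mathrm{Gr}(e,f)$ is the Grassmannian of $e$-dimensional subspaces of $K^f$, and its dimension is $\langle\eta,\chi-\eta\rangle$. (2) The irreducible components of $\mathrm{Gr}(t,M)$ are exactly the sets $\mathrm{Gr}(\eta,M)$ for $\eta\in C_\chi(t)$, and distinct $\eta$ give distinct components. -/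

import Mathlib

/-! ## Characters of a finite group -/

/-- `φ` is a `K`-character of `E`: it is afforded by a finite-dimensional representation. -/
def IsKCharacter (K E : Type*) [Field K] [Group E] (φ : E → K) : Prop :=
  ∃ (n : ℕ) (τ : Representation K E (Fin n → K)), τ.character = φ

/-- `φ` is an irreducible `K`-character of `E`: it is afforded by a simple module. -/
def IsIrrKCharacter (K E : Type*) [Field K] [Group E] (φ : E → K) : Prop :=
  ∃ (n : ℕ) (τ : Representation K E (Fin n → K)), τ.IsIrreducible ∧ τ.character = φ

/-- The set `Irr_K(E)` of irreducible `K`-characters of `E`. -/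
abbrev IrrK (K E : Type*) [Field K] [Group E] : Type _ :=
  {φ : E → K // IsIrrKCharacter K E φ}

/-- The class function `∑ e_μ μ` with multiplicities `e`. -/
noncomputable def charSum {K E : Type*} [Field K] [Group E] (e : IrrK K E →₀ ℕ) : E → K :=
  e.sum fun μ m => m • (μ : E → K)

open Classical in
/-- The multiplicities `e_μ` in the decomposition `φ = ∑ e_μ μ` of a `K`-character `φ`
(zero if `φ` has no such decomposition). -/
noncomputable def charMult {K E : Type*} [Field K] [Group E] (φ : E → K) : IrrK K E →₀ ℕ :=
  if h : ∃ e : IrrK K E →₀ ℕ, charSum e = φ then h.choose else 0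

/-- The scalar product `⟨φ, ψ⟩ = ∑ e_μ e'_μ` of `φ = ∑ e_μ μ` and `ψ = ∑ e'_μ μ`. -/
noncomputable def charInner {K E : Type*} [Field K] [Group E] (φ ψ : E → K) : ℕ :=
  (charMult φ).sum fun μ m => m * charMult ψ μ

/-- The `K`-character `η` is a constituent of the `K`-character `χ`. -/
def IsConstituent {K E : Type*} [Field K] [Group E] (η χ : E → K) : Prop :=
  IsKCharacter K E η ∧ IsKCharacter K E χ ∧ ∀ μ, charMult η μ ≤ charMult χ μ

/-- `C_χ(t)`: the constituents of `χ` of degree `t`. -/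
def constituents {K E : Type*} [Field K] [Group E] (χ : E → K) (t : ℕ) : Set (E → K) :=
  {η | IsConstituent η χ ∧ η 1 = (t : K)}

/-! ## Spaces with functions and morphisms of varieties -/

/-- A set of points with a topology and a notion of regularity of `K`-valued functions.
`RegularAt f x` means that `f` is regular in a neighbourhood of `x`; the functions regular on an
open set are those regular at all of its points. -/
structure SpaceWithFunctions (K : Type*) where
  carrier : Type*
  topology : TopologicalSpace carrier
  RegularAt : (carrier → K) → carrier → Prop

namespace SpaceWithFunctions

instance instTopology {K : Type*} (X : SpaceWithFunctions K) : TopologicalSpace X.carrier :=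
  X.topology

/-- A morphism: a continuous map which pulls regular functions back to regular functions. -/
def IsMorphism {K : Type*} {X Y : SpaceWithFunctions K} (φ : X.carrier → Y.carrier) : Prop :=
  Continuous φ ∧
    ∀ (x : X.carrier) (f : Y.carrier → K), Y.RegularAt f (φ x) → X.RegularAt (f ∘ φ) x

/-- Isomorphism: a bijection which is a morphism in both directions. -/
def Isomorphic {K : Type*} (X Y : SpaceWithFunctions K) : Prop :=
  ∃ φ : X.carrier ≃ Y.carrier,
    IsMorphism (X := X) (Y := Y) φ ∧ IsMorphism (X := Y) (Y := X) φ.symm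

/-- The structure induced on `Y` along a map `j : Y → X` (used for injective `j`): the induced
topology, and the functions which are locally restrictions of regular functions of `X`. -/
def induced {K Y : Type*} (X : SpaceWithFunctions K) (j : Y → X.carrier) :
    SpaceWithFunctions K where
  carrier := Y
  topology := X.topology.induced j
  RegularAt f y := ∃ g : X.carrier → K, X.RegularAt g (j y) ∧
    ∃ U : Set X.carrier, IsOpen U ∧ j y ∈ U ∧ ∀ z : Y, j z ∈ U → f z = g (j z)

/-- A subset `S` of `X` with its induced structure. -/
def subspace {K : Type*} (X : SpaceWithFunctions K) (S : Set X.carrier) :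
    SpaceWithFunctions K :=
  X.induced (Subtype.val : S → X.carrier)

/-- The Zariski structure on a set `X` of points with coordinate vectors `rep x` in `A`, for a
family `form d` of sets of functions on `A` (the forms of degree `d`). The sets
`{x | P (rep x) ≠ 0}` with `P` a form generate the topology; a function is regular if it is locally
a quotient of two forms of equal degree. -/
def ofForms {K X A D : Type*} [Field K] (rep : X → A) (form : D → Set (A → K)) :
    SpaceWithFunctions K where
  carrier := X
  topology := TopologicalSpace.generateFrom
    {U | ∃ d, ∃ P ∈ form d, U = {x | P (rep x) ≠ 0}}
  RegularAt f x := ∃ d, ∃ P ∈ form d, ∃ Q ∈ form d, ∃ U : Set X,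
    (TopologicalSpace.generateFrom
      {U | ∃ d, ∃ P ∈ form d, U = {x | P (rep x) ≠ 0}}).IsOpen U ∧
    x ∈ U ∧ ∀ y ∈ U, Q (rep y) ≠ 0 ∧ f y = P (rep y) / Q (rep y)

end SpaceWithFunctions

/-- The polynomial functions on a vector space: the algebra generated by the linear forms. -/
def polyFunctions (K A : Type*) [Field K] [AddCommGroup A] [Module K A] :
    Subalgebra K (A → K) :=
  Algebra.adjoin K (Set.range fun l : Module.Dual K A => (l : A → K))

/-- Affine `n`-space over `K`. -/
def affineSpace (K : Type*) [Field K] (n : ℕ) : SpaceWithFunctions K :=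
  SpaceWithFunctions.ofForms (X := Fin n → K) (D := Unit) id
    fun _ => (polyFunctions K (Fin n → K) : Set ((Fin n → K) → K))

/-- The homogeneous polynomial functions of degree `d` on `W` (for infinite `K`). -/
def homogeneousForms (K W : Type*) [Field K] [AddCommGroup W] [Module K W] (d : ℕ) :
    Set (W → K) :=
  {P | P ∈ polyFunctions K W ∧ ∀ (c : K) (w : W), P (c • w) = c ^ d * P w}

/-- The projective space `ℙ(W)` of lines in `W`. -/
noncomputable def projectiveSpace (K W : Type*) [Field K] [AddCommGroup W] [Module K W] :
    SpaceWithFunctions K :=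
  SpaceWithFunctions.ofForms (X := Projectivization K W) Projectivization.rep
    (homogeneousForms K W)

/-- The multihomogeneous polynomial functions of multidegree `d` on `∏ W i` (for infinite `K`). -/
def multihomogeneousForms (K : Type*) {ι : Type*} (W : ι → Type*) [Field K] [Fintype ι]
    [∀ i, AddCommGroup (W i)] [∀ i, Module K (W i)] (d : ι → ℕ) : Set ((∀ i, W i) → K) :=
  {P | P ∈ polyFunctions K (∀ i, W i) ∧
    ∀ (c : ι → K) (w : ∀ i, W i), P (fun i => c i • w i) = (∏ i, c i ^ d i) * P w}

/-- The product variety `∏ ℙ(W i)`. -/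
noncomputable def multiprojectiveSpace (K : Type*) {ι : Type*} (W : ι → Type*) [Field K]
    [Fintype ι] [∀ i, AddCommGroup (W i)] [∀ i, Module K (W i)] : SpaceWithFunctions K :=
  SpaceWithFunctions.ofForms (X := ∀ i, Projectivization K (W i)) (fun p i => (p i).rep)
    (multihomogeneousForms K W)

/-- `X` is birational to an affine space: some nonempty open subset of `X` is isomorphic to a
nonempty open subset of an affine space. (For irreducible `X` this says that `X` is rational.) -/
def IsRational {K : Type*} [Field K] (X : SpaceWithFunctions K) : Prop :=
  ∃ (n : ℕ) (U : Set X.carrier) (U' : Set (affineSpace K n).carrier),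
    IsOpen U ∧ U.Nonempty ∧ IsOpen U' ∧ U'.Nonempty ∧
      (X.subspace U).Isomorphic ((affineSpace K n).subspace U')

/-! ## Grassmannians -/

/-- For a `t`-dimensional subspace `U` of `V`, the image of `⋀ᵗ U` in `⋀ᵗ V` is a line. -/
theorem finrank_range_exteriorPower_map {K V : Type*} [Field K] [AddCommGroup V] [Module K V]
    [FiniteDimensional K V] {t : ℕ} (U : Submodule K V) (hU : Module.finrank K U = t) :
    Module.finrank K (LinearMap.range (exteriorPower.map t U.subtype)) = 1 := by
  rw [LinearMap.finrank_range_of_inj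
    (exteriorPower.map_injective_field U.injective_subtype),
    exteriorPower.finrank_eq, hU, Nat.choose_self]

/-- The Plücker point of a `t`-dimensional subspace `U` of `V`: the line `⋀ᵗ U` in `⋀ᵗ V`. -/
noncomputable def pluckerPoint {K V : Type*} [Field K] [AddCommGroup V] [Module K V]
    [FiniteDimensional K V] {t : ℕ} (U : {U : Submodule K V // Module.finrank K U = t}) :
    Projectivization K (⋀[K]^t V) :=
  Projectivization.mk'' (LinearMap.range (exteriorPower.map t U.1.subtype))
    (finrank_range_exteriorPower_map U.1 U.2)

/-- The Grassmannian `Gr(t, V)`, with the structure induced from `ℙ(⋀ᵗ V)` by the Plücker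
embedding. -/
noncomputable def grassmannian (K V : Type*) [Field K] [AddCommGroup V] [Module K V]
    [FiniteDimensional K V] (t : ℕ) : SpaceWithFunctions K :=
  (projectiveSpace K (⋀[K]^t V)).induced
    (pluckerPoint : {U : Submodule K V // Module.finrank K U = t} → _)

/-- The product variety `∏ Gr(e i, f i)`, where `Gr(e, f)` is the Grassmannian of `e`-dimensional
subspaces of `K ^ f`, embedded in `∏ ℙ(⋀^(e i) K^(f i))`. -/
noncomputable def prodGrassmannian (K : Type*) {ι : Type*} [Field K] [Fintype ι] (e f : ι → ℕ) :
    SpaceWithFunctions K :=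
  (multiprojectiveSpace K fun i => ⋀[K]^(e i) (Fin (f i) → K)).induced
    (fun (U : ∀ i, {U : Submodule K (Fin (f i) → K) // Module.finrank K U = e i}) i =>
      pluckerPoint (U i))

/-- The Plücker point of a `t`-dimensional submodule of `M = (V, ρ)`. -/
noncomputable def subrepPluckerPoint {K E V : Type*} [Field K] [Group E] [AddCommGroup V]
    [Module K V] [FiniteDimensional K V] {ρ : Representation K E V} {t : ℕ}
    (σ : {σ : Subrepresentation ρ // Module.finrank K σ.toSubmodule = t}) :
    Projectivization K (⋀[K]^t V) :=
  pluckerPoint ⟨σ.1.toSubmodule, σ.2⟩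

/-- The invariant Grassmannian `Gr(t, M)` of `t`-dimensional submodules of `M = (V, ρ)`, with the
structure induced from `Gr(t, V)`, that is, from `ℙ(⋀ᵗ V)`. -/
noncomputable def invGrassmannian {K E V : Type*} [Field K] [Group E] [AddCommGroup V]
    [Module K V] [FiniteDimensional K V] (ρ : Representation K E V) (t : ℕ) :
    SpaceWithFunctions K :=
  (projectiveSpace K (⋀[K]^t V)).induced
    (subrepPluckerPoint :
      {σ : Subrepresentation ρ // Module.finrank K σ.toSubmodule = t} → _)

/-- `Gr(η, M)` inside `Gr(t, M)`: the `t`-dimensional submodules of `M` affording `η`. -/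
def charGrassmannian {K E V : Type*} [Field K] [Group E] [AddCommGroup V]
    [Module K V] [FiniteDimensional K V] (ρ : Representation K E V) (t : ℕ) (η : E → K) :
    Set (invGrassmannian ρ t).carrier :=
  {σ : {σ : Subrepresentation ρ // Module.finrank K σ.toSubmodule = t} |
    σ.1.toRepresentation.character = η}

/-! Fix a simple module S_μ for every irreducible character μ. Complete reducibility and Schur's
lemma show that a submodule U of M is the same thing as a family of subspaces Hom_E(S_μ, U) of the
multiplicity spaces Hom_E(S_μ, M) ≅ K^(f_μ), and that the dimensions of these subspaces are the
multiplicities of the character of U. As a set, Gr(η, M) is therefore the product of the Gr(e_μ,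
f_μ).

The bijection becomes an isomorphism of varieties through frames. A map into a Grassmannian is a
morphism as soon as it locally has a regular frame, because Plücker coordinates are multilinear in
the frame. Conversely Cramer's rule recovers a regular frame from the Plücker coordinates wherever a
given minor does not vanish (`dualFrame_spec`). Both directions of the bijection act on frames by
fixed linear maps: U is sent to its images under `isoProj` (`map_isoProj`), and a family of
subspaces is sent to the span of its images under `isoIncl`. So they carry regular frames to regular
frames (`charGrassmannian_isomorphic`).

Geometry is then read off the product. Its standard charts are affine spaces of dimension ∑ e_μ(f_μ
- e_μ), which gives rationality and dimension; it is the image under "span" of an open set of tuples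
of frames in an affine space, which gives irreducibility.

For closedness, invariance under E is a closed condition, and each multiplicity is the rank of a
fixed linear map on U, so it can only rise nearby. Two distinct characters of equal degree cannot
have comparable multiplicities, so a submodule not affording η has some multiplicity larger than
that of η, and this persists nearby (`isClosed_setOf_character`). The Plücker image being closed
transfers this to projective space. Finally Gr(t, M) is the disjoint union of finitely many closed
irreducible sets Gr(η, M), which must be its components. -/

open Filter Topology in
/-- The regular functions of `X` form a sheaf of local rings of `K`-valued functions. -/
structure SpaceWithFunctions.IsGeometric {K : Type*} [Field K] (X : SpaceWithFunctions K) :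
    Prop where
  const : ∀ (c : K) (x : X.carrier), X.RegularAt (fun _ => c) x
  add : ∀ {f g : X.carrier → K} {x : X.carrier}, X.RegularAt f x → X.RegularAt g x →
    X.RegularAt (fun y => f y + g y) x
  mul : ∀ {f g : X.carrier → K} {x : X.carrier}, X.RegularAt f x → X.RegularAt g x →
    X.RegularAt (fun y => f y * g y) x
  inv : ∀ {f : X.carrier → K} {x : X.carrier}, X.RegularAt f x → f x ≠ 0 →
    X.RegularAt (fun y => (f y)⁻¹) x
  congr : ∀ {f g : X.carrier → K} {x : X.carrier}, X.RegularAt f x → (∀ᶠ y in 𝓝 x, f y = g y) →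
    X.RegularAt g x
  eventually : ∀ {f : X.carrier → K} {x : X.carrier}, X.RegularAt f x →
    ∀ᶠ y in 𝓝 x, X.RegularAt f y
  ne_zero : ∀ {f : X.carrier → K} {x : X.carrier}, X.RegularAt f x → f x ≠ 0 →
    ∀ᶠ y in 𝓝 x, f y ≠ 0

/-- A family of sets of functions which is graded-multiplicative, like the homogeneous forms. -/
structure IsFormFamily {K A D : Type*} [Field K] [AddCommMonoid D] (form : D → Set (A → K)) :
    Prop where
  one : (fun _ => 1) ∈ form 0
  add : ∀ {d P Q}, P ∈ form d → Q ∈ form d → (fun a => P a + Q a) ∈ form d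
  smul : ∀ {d P} (c : K), P ∈ form d → (fun a => c * P a) ∈ form d
  mul : ∀ {d d' P Q}, P ∈ form d → Q ∈ form d' → (fun a => P a * Q a) ∈ form (d + d')

/-! ### Regular functions, induced structures and morphisms. -/

namespace SpaceWithFunctions

open Filter Topology

section OfForms

variable {K X A D : Type*} [Field K] {rep : X → A} {form : D → Set (A → K)}

theorem isOpen_ofForms {d : D} {P : A → K} (hP : P ∈ form d) :
    IsOpen (X := (ofForms rep form).carrier) {x | P (rep x) ≠ 0} :=
  TopologicalSpace.isOpen_generateFrom_of_mem ⟨d, P, hP, rfl⟩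

theorem eventually_ofForms_ne_zero {d : D} {P : A → K} (hP : P ∈ form d)
    {x : (ofForms rep form).carrier} (hx : P (rep x) ≠ 0) :
    ∀ᶠ y : (ofForms rep form).carrier in 𝓝 x, P (rep y) ≠ 0 :=
  (isOpen_ofForms hP).mem_nhds hx

theorem regularAt_ofForms_iff {f : (ofForms rep form).carrier → K}
    {x : (ofForms rep form).carrier} :
    (ofForms rep form).RegularAt f x ↔ ∃ d, ∃ P ∈ form d, ∃ Q ∈ form d,
      ∀ᶠ y : (ofForms rep form).carrier in 𝓝 x, Q (rep y) ≠ 0 ∧ f y = P (rep y) / Q (rep y) := by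
  constructor
  · rintro ⟨d, P, hP, Q, hQ, U, hU, hx, h⟩
    exact ⟨d, P, hP, Q, hQ, mem_of_superset (IsOpen.mem_nhds (X := (ofForms rep form).carrier) hU hx) h⟩
  · rintro ⟨d, P, hP, Q, hQ, h⟩
    obtain ⟨U, hUs, hU, hx⟩ := mem_nhds_iff.1 h
    exact ⟨d, P, hP, Q, hQ, U, hU, hx, hUs⟩

theorem isGeometric_ofForms [AddCommMonoid D] (hform : IsFormFamily form) :
    (ofForms rep form).IsGeometric where
  const c x := regularAt_ofForms_iff.2
    ⟨0, _, hform.smul c hform.one, _, hform.one, Eventually.of_forall fun y => by simp⟩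
  add := by
    intro f g x hf hg
    obtain ⟨d, P, hP, Q, hQ, h⟩ := regularAt_ofForms_iff.1 hf
    obtain ⟨d', P', hP', Q', hQ', h'⟩ := regularAt_ofForms_iff.1 hg
    refine regularAt_ofForms_iff.2 ⟨d + d', _, hform.add (hform.mul hP hQ') (hform.mul hQ hP'), _,
      hform.mul hQ hQ', ?_⟩
    filter_upwards [h, h'] with y hy hy'
    exact ⟨mul_ne_zero hy.1 hy'.1, by rw [hy.2, hy'.2, div_add_div _ _ hy.1 hy'.1]⟩
  mul := by
    intro f g x hf hg
    obtain ⟨d, P, hP, Q, hQ, h⟩ := regularAt_ofForms_iff.1 hf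
    obtain ⟨d', P', hP', Q', hQ', h'⟩ := regularAt_ofForms_iff.1 hg
    refine regularAt_ofForms_iff.2 ⟨d + d', _, hform.mul hP hP', _, hform.mul hQ hQ', ?_⟩
    filter_upwards [h, h'] with y hy hy'
    exact ⟨mul_ne_zero hy.1 hy'.1, by rw [hy.2, hy'.2, div_mul_div_comm]⟩
  inv := by
    intro f x hf hx
    obtain ⟨d, P, hP, Q, hQ, h⟩ := regularAt_ofForms_iff.1 hf
    have hPx : P (rep x) ≠ 0 := fun h0 => hx (by rw [h.self_of_nhds.2, h0, zero_div])
    refine regularAt_ofForms_iff.2 ⟨d, Q, hQ, P, hP, ?_⟩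
    filter_upwards [h, eventually_ofForms_ne_zero hP hPx] with y hy hy'
    exact ⟨hy', by rw [hy.2, inv_div]⟩
  congr := by
    intro f g x hf hfg
    obtain ⟨d, P, hP, Q, hQ, h⟩ := regularAt_ofForms_iff.1 hf
    refine regularAt_ofForms_iff.2 ⟨d, P, hP, Q, hQ, ?_⟩
    filter_upwards [h, hfg] with y hy hy'
    exact ⟨hy.1, hy'.symm.trans hy.2⟩
  eventually := by
    intro f x hf
    obtain ⟨d, P, hP, Q, hQ, h⟩ := regularAt_ofForms_iff.1 hf
    filter_upwards [eventually_eventually_nhds.2 h] with y hy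
    exact regularAt_ofForms_iff.2 ⟨d, P, hP, Q, hQ, hy⟩
  ne_zero := by
    intro f x hf hx
    obtain ⟨d, P, hP, Q, hQ, h⟩ := regularAt_ofForms_iff.1 hf
    have hPx : P (rep x) ≠ 0 := fun h0 => hx (by rw [h.self_of_nhds.2, h0, zero_div])
    filter_upwards [h, eventually_ofForms_ne_zero hP hPx] with y hy hy'
    rw [hy.2]
    exact div_ne_zero hy' hy.1

/-- A quotient of two forms of equal degree is regular where the denominator does not vanish. -/
theorem regularAt_ofForms_div {d : D} {P Q : A → K} (hP : P ∈ form d) (hQ : Q ∈ form d)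
    {x : (ofForms rep form).carrier} (hx : Q (rep x) ≠ 0) :
    (ofForms rep form).RegularAt (fun y => P (rep y) / Q (rep y)) x :=
  regularAt_ofForms_iff.2 ⟨d, P, hP, Q, hQ, by
    filter_upwards [eventually_ofForms_ne_zero hQ hx] with y hy using ⟨hy, rfl⟩⟩

/-- A map which locally lifts to coordinate vectors on which forms are regular is a morphism. -/
theorem isMorphism_ofForms {Z : SpaceWithFunctions K} (hZ : Z.IsGeometric)
    {φ : Z.carrier → (ofForms rep form).carrier}
    (h : ∀ z, ∃ F : Z.carrier → A,
      (∀ d, ∀ P ∈ form d, Z.RegularAt (fun y => P (F y)) z) ∧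
      ∀ᶠ y in 𝓝 z, ∀ d, ∃ c : K, c ≠ 0 ∧ ∀ P ∈ form d, P (rep (φ y)) = c * P (F y)) :
    IsMorphism (X := Z) (Y := ofForms rep form) φ := by
  -- The factor `c` is nonzero, so the vanishing of a form can be tested on the regular lift `F`
  -- instead of on `rep`.
  have key : ∀ z d, ∀ P ∈ form d, P (rep (φ z)) ≠ 0 → ∀ᶠ y in 𝓝 z, P (rep (φ y)) ≠ 0 := by
    intro z d P hP hz
    obtain ⟨F, hF, hc⟩ := h z
    obtain ⟨c, -, h0⟩ := hc.self_of_nhds d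
    have h1 : P (F z) ≠ 0 := fun h1 => hz (by rw [h0 P hP, h1, mul_zero])
    filter_upwards [hc, hZ.ne_zero (hF d P hP) h1] with y hy hy'
    obtain ⟨c, hc0, hc⟩ := hy d
    rw [hc P hP]
    exact mul_ne_zero hc0 hy'
  have hcont : Continuous φ := by
    refine continuous_generateFrom_iff.2 ?_
    rintro _ ⟨d, P, hP, rfl⟩
    exact isOpen_iff_mem_nhds.2 fun z hz => key z d P hP hz
  refine ⟨hcont, fun z f hf => ?_⟩
  obtain ⟨d, P, hP, Q, hQ, hPQ⟩ := regularAt_ofForms_iff.1 hf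
  obtain ⟨F, hF, hc⟩ := h z
  have hQz : Q (F z) ≠ 0 := fun h1 => by
    obtain ⟨c, -, h0⟩ := hc.self_of_nhds d
    exact hPQ.self_of_nhds.1 (by rw [h0 Q hQ, h1, mul_zero])
  -- `P` and `Q` have the same degree, hence the same factor `c`, which cancels in the quotient.
  refine hZ.congr (hZ.mul (hF d P hP) (hZ.inv (hF d Q hQ) hQz)) ?_
  filter_upwards [hc, hcont.continuousAt.eventually hPQ] with y hy hy'
  obtain ⟨c, hc0, hc⟩ := hy d
  rw [Function.comp_apply, hy'.2, hc P hP, hc Q hQ, mul_div_mul_left _ _ hc0, div_eq_mul_inv]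

end OfForms

section Induced

variable {K Y : Type*} {X : SpaceWithFunctions K} {j : Y → X.carrier}

theorem nhds_induced_eq (y : (X.induced j).carrier) :
    𝓝 y = comap j (𝓝 (j y)) :=
  @nhds_induced _ _ X.topology j y

theorem regularAt_induced_iff {f : (X.induced j).carrier → K} {y : (X.induced j).carrier} :
    (X.induced j).RegularAt f y ↔ ∃ g : X.carrier → K, X.RegularAt g (j y) ∧
      ∀ᶠ z in 𝓝 y, f z = g (j z) := by
  constructor
  · rintro ⟨g, hg, U, hU, hy, h⟩
    refine ⟨g, hg, ?_⟩
    rw [nhds_induced_eq]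
    exact mem_comap.2 ⟨U, hU.mem_nhds hy, fun z hz => h z hz⟩
  · rintro ⟨g, hg, h⟩
    rw [nhds_induced_eq] at h
    obtain ⟨U, hU, hUs⟩ := mem_comap.1 h
    obtain ⟨W, hWU, hW, hy⟩ := mem_nhds_iff.1 hU
    exact ⟨g, hg, W, hW, hy, fun z hz => hUs (hWU hz)⟩

theorem continuous_induced : Continuous (X := (X.induced j).carrier) j :=
  continuous_induced_dom

theorem isMorphism_induced :
    IsMorphism (X := X.induced j) (Y := X) j :=
  ⟨continuous_induced, fun _ f hf =>
    regularAt_induced_iff.2 ⟨f, hf, Eventually.of_forall fun _ => rfl⟩⟩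

theorem IsGeometric.induced [Field K] (hX : X.IsGeometric) : (X.induced j).IsGeometric where
  const c x := regularAt_induced_iff.2 ⟨_, hX.const c _, Eventually.of_forall fun _ => rfl⟩
  add := by
    intro f g x hf hg
    obtain ⟨f', hf', hf⟩ := regularAt_induced_iff.1 hf
    obtain ⟨g', hg', hg⟩ := regularAt_induced_iff.1 hg
    refine regularAt_induced_iff.2 ⟨_, hX.add hf' hg', ?_⟩
    filter_upwards [hf, hg] with y h1 h2 using by rw [h1, h2]
  mul := by
    intro f g x hf hg
    obtain ⟨f', hf', hf⟩ := regularAt_induced_iff.1 hf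
    obtain ⟨g', hg', hg⟩ := regularAt_induced_iff.1 hg
    refine regularAt_induced_iff.2 ⟨_, hX.mul hf' hg', ?_⟩
    filter_upwards [hf, hg] with y h1 h2 using by rw [h1, h2]
  inv := by
    intro f x hf hx
    obtain ⟨f', hf', hf⟩ := regularAt_induced_iff.1 hf
    refine regularAt_induced_iff.2 ⟨_, hX.inv hf' (hf.self_of_nhds ▸ hx), ?_⟩
    filter_upwards [hf] with y h1 using by rw [h1]
  congr := by
    intro f g x hf hfg
    obtain ⟨f', hf', hf⟩ := regularAt_induced_iff.1 hf
    refine regularAt_induced_iff.2 ⟨_, hf', ?_⟩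
    filter_upwards [hf, hfg] with y h1 h2 using by rw [← h2, h1]
  eventually := by
    intro f x hf
    obtain ⟨f', hf', hf⟩ := regularAt_induced_iff.1 hf
    filter_upwards [eventually_eventually_nhds.2 hf,
      continuous_induced.continuousAt.eventually (hX.eventually hf')] with y h1 h2
    exact regularAt_induced_iff.2 ⟨_, h2, h1⟩
  ne_zero := by
    intro f x hf hx
    obtain ⟨f', hf', hf⟩ := regularAt_induced_iff.1 hf
    filter_upwards [hf, continuous_induced.continuousAt.eventually
      (hX.ne_zero hf' (hf.self_of_nhds ▸ hx))] with y h1 h2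
    rwa [h1]

/-- Universal property of the induced structure: its regular functions are locally pulled back along
`j`, so only the composite with `j` needs checking. -/
theorem isMorphism_induced_of_comp [Field K] {Z : SpaceWithFunctions K} (hZ : Z.IsGeometric)
    {φ : Z.carrier → (X.induced j).carrier} (h : IsMorphism (X := Z) (Y := X) (fun z => j (φ z))) :
    IsMorphism (X := Z) (Y := X.induced j) φ := by
  have hcont : Continuous φ := continuous_induced_rng.2 h.1
  refine ⟨hcont, fun z f hf => ?_⟩
  obtain ⟨g, hg, hfg⟩ := regularAt_induced_iff.1 hf
  refine hZ.congr (h.2 z g hg) ?_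
  filter_upwards [hcont.continuousAt.eventually hfg] with y hy
  rw [Function.comp_apply, Function.comp_apply, hy]

end Induced

section Morphisms

variable {K : Type*} {X Y Z : SpaceWithFunctions K}

theorem IsMorphism.comp {ψ : Y.carrier → Z.carrier} {φ : X.carrier → Y.carrier}
    (hψ : IsMorphism (X := Y) (Y := Z) ψ) (hφ : IsMorphism (X := X) (Y := Y) φ) :
    IsMorphism (X := X) (Y := Z) (ψ ∘ φ) :=
  ⟨hψ.1.comp hφ.1, fun x f hf => hφ.2 x (f ∘ ψ) (hψ.2 (φ x) f hf)⟩

theorem Isomorphic.symm (h : X.Isomorphic Y) : Y.Isomorphic X :=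
  let ⟨φ, h1, h2⟩ := h
  ⟨φ.symm, h2, h1⟩

theorem Isomorphic.trans (h : X.Isomorphic Y) (h' : Y.Isomorphic Z) : X.Isomorphic Z :=
  let ⟨φ, h1, h2⟩ := h
  let ⟨ψ, h3, h4⟩ := h'
  ⟨φ.trans ψ, h3.comp h1, h2.comp h4⟩

theorem Isomorphic.nonempty_homeomorph (h : X.Isomorphic Y) :
    Nonempty (X.carrier ≃ₜ Y.carrier) :=
  let ⟨φ, h1, h2⟩ := h
  ⟨⟨φ, h1.1, h2.1⟩⟩

end Morphisms

/-- Isomorphisms restrict to open (in fact arbitrary) subsets. -/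
theorem isomorphic_subspace_image {K : Type*} [Field K] {X Y : SpaceWithFunctions K}
    (hX : X.IsGeometric) (hY : Y.IsGeometric) (φ : X.carrier ≃ Y.carrier)
    (h1 : IsMorphism (X := X) (Y := Y) φ) (h2 : IsMorphism (X := Y) (Y := X) φ.symm)
    (S : Set X.carrier) : (X.subspace S).Isomorphic (Y.subspace (φ '' S)) := by
  refine ⟨φ.image S, ?_, ?_⟩
  · exact isMorphism_induced_of_comp hX.induced (h1.comp isMorphism_induced)
  · refine isMorphism_induced_of_comp hY.induced ?_
    convert h2.comp (isMorphism_induced (j := (Subtype.val : φ '' S → Y.carrier))) using 1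
    ext ⟨_, x, hx, rfl⟩
    exact congrArg Subtype.val ((φ.image S).symm_apply_apply ⟨x, hx⟩) |>.trans
      (φ.symm_apply_apply x).symm

theorem Isomorphic.isRational {K : Type*} [Field K] {X Y : SpaceWithFunctions K}
    (hX : X.IsGeometric) (hY : Y.IsGeometric) (h : X.Isomorphic Y) (hr : IsRational X) :
    IsRational Y := by
  obtain ⟨φ, h1, h2⟩ := h
  obtain ⟨n, U, U', hU, hUn, hU', hUn', hiso⟩ := hr
  refine ⟨n, φ '' U, U', ?_, hUn.image _, hU', hUn',
    (isomorphic_subspace_image hX hY φ h1 h2 U).symm.trans hiso⟩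
  rw [φ.image_eq_preimage_symm]
  exact hU.preimage h2.1

end SpaceWithFunctions

/-! ### Polynomial, homogeneous and multihomogeneous functions. -/

section PolyFunctions

variable {K : Type*} [Field K]

theorem isFormFamily_polyFunctions (A : Type*) [AddCommGroup A] [Module K A] :
    IsFormFamily fun _ : Unit => (polyFunctions K A : Set (A → K)) where
  one := one_mem (polyFunctions K A)
  add hP hQ := add_mem (S := Subalgebra K (A → K)) hP hQ
  smul c hP := (polyFunctions K A).smul_mem hP c
  mul hP hQ := mul_mem (S := Subalgebra K (A → K)) hP hQ

theorem isFormFamily_homogeneousForms (W : Type*) [AddCommGroup W] [Module K W] :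
    IsFormFamily (homogeneousForms K W) where
  one := ⟨one_mem (polyFunctions K W), fun c w => by simp⟩
  add hP hQ := ⟨add_mem (S := Subalgebra K (W → K)) hP.1 hQ.1, fun c w => by
    beta_reduce; rw [hP.2, hQ.2, mul_add]⟩
  smul c hP := ⟨(polyFunctions K W).smul_mem hP.1 c, fun a w => by beta_reduce; rw [hP.2, mul_left_comm]⟩
  mul hP hQ := ⟨mul_mem (S := Subalgebra K (W → K)) hP.1 hQ.1, fun c w => by
    beta_reduce; rw [hP.2, hQ.2, pow_add, mul_mul_mul_comm]⟩

theorem isFormFamily_multihomogeneousForms {ι : Type*} [Fintype ι] (W : ι → Type*)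
    [∀ i, AddCommGroup (W i)] [∀ i, Module K (W i)] :
    IsFormFamily (multihomogeneousForms K W) where
  one := ⟨one_mem (polyFunctions K (∀ i, W i)), fun c w => by simp⟩
  add hP hQ := ⟨add_mem (S := Subalgebra K ((∀ i, W i) → K)) hP.1 hQ.1, fun c w => by
    beta_reduce; rw [hP.2, hQ.2, mul_add]⟩
  smul c hP := ⟨(polyFunctions K (∀ i, W i)).smul_mem hP.1 c, fun a w => by
    beta_reduce; rw [hP.2, mul_left_comm]⟩
  mul hP hQ := ⟨mul_mem (S := Subalgebra K ((∀ i, W i) → K)) hP.1 hQ.1, fun c w => by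
    simp only [Pi.add_apply, pow_add, Finset.prod_mul_distrib]
    rw [hP.2, hQ.2, mul_mul_mul_comm]⟩

theorem dual_mem_polyFunctions {W : Type*} [AddCommGroup W] [Module K W] (l : Module.Dual K W) :
    (fun w => l w) ∈ polyFunctions K W :=
  Algebra.subset_adjoin ⟨l, rfl⟩

theorem dual_mem_homogeneousForms {W : Type*} [AddCommGroup W] [Module K W]
    (l : Module.Dual K W) : (fun w => l w) ∈ homogeneousForms K W 1 :=
  ⟨dual_mem_polyFunctions l, fun c w => by beta_reduce; rw [map_smul, pow_one, smul_eq_mul]⟩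

theorem dual_proj_mem_multihomogeneousForms {ι : Type*} [Fintype ι] [DecidableEq ι]
    {W : ι → Type*} [∀ i, AddCommGroup (W i)] [∀ i, Module K (W i)] (i : ι)
    (l : Module.Dual K (W i)) :
    (fun w : ∀ i, W i => l (w i)) ∈ multihomogeneousForms K W (Pi.single i 1) := by
  refine ⟨dual_mem_polyFunctions (l ∘ₗ LinearMap.proj i), fun c w => ?_⟩
  beta_reduce
  rw [map_smul, smul_eq_mul, Finset.prod_eq_single i]
  · simp
  · intro j _ hj
    simp [hj]
  · simp

end PolyFunctions

/-! ### Regular vector-valued functions, and morphisms to affine and projective spaces. -/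

namespace SpaceWithFunctions

open Filter Topology

section RegularVec

variable {K : Type*} [Field K] {X : SpaceWithFunctions K}

theorem IsGeometric.sum (hX : X.IsGeometric) {ι : Type*} (s : Finset ι)
    {f : ι → X.carrier → K} {x : X.carrier} (hf : ∀ i ∈ s, X.RegularAt (f i) x) :
    X.RegularAt (fun y => ∑ i ∈ s, f i y) x := by
  classical
  induction s using Finset.induction_on with
  | empty => simpa using hX.const 0 x
  | insert a s ha ih =>
    simp only [Finset.sum_insert ha]
    exact hX.add (hf a (Finset.mem_insert_self a s))
      (ih fun i hi => hf i (Finset.mem_insert_of_mem hi))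

theorem IsGeometric.prod (hX : X.IsGeometric) {ι : Type*} (s : Finset ι)
    {f : ι → X.carrier → K} {x : X.carrier} (hf : ∀ i ∈ s, X.RegularAt (f i) x) :
    X.RegularAt (fun y => ∏ i ∈ s, f i y) x := by
  classical
  induction s using Finset.induction_on with
  | empty => simpa using hX.const 1 x
  | insert a s ha ih =>
    simp only [Finset.prod_insert ha]
    exact hX.mul (hf a (Finset.mem_insert_self a s))
      (ih fun i hi => hf i (Finset.mem_insert_of_mem hi))

variable {V W : Type*} [AddCommGroup V] [Module K V] [AddCommGroup W] [Module K W]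

variable (X) in
/-- A vector-valued function is regular if all its coordinates are. -/
def RegularVec (F : X.carrier → W) (x : X.carrier) : Prop :=
  ∀ l : Module.Dual K W, X.RegularAt (fun y => l (F y)) x

theorem RegularVec.map {F : X.carrier → V} {x : X.carrier} (hF : X.RegularVec F x)
    (L : V →ₗ[K] W) : X.RegularVec (fun y => L (F y)) x :=
  fun l => hF (l ∘ₗ L)

theorem IsGeometric.regularVec_const (hX : X.IsGeometric) (w : W) (x : X.carrier) :
    X.RegularVec (fun _ => w) x :=
  fun _ => hX.const _ x

theorem RegularVec.add (hX : X.IsGeometric) {F G : X.carrier → W} {x : X.carrier}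
    (hF : X.RegularVec F x) (hG : X.RegularVec G x) :
    X.RegularVec (fun y => F y + G y) x := by
  intro l
  simp only [map_add]
  exact hX.add (hF l) (hG l)

theorem RegularVec.pi (hX : X.IsGeometric) {ι : Type*} [Fintype ι] {W : ι → Type*}
    [∀ i, AddCommGroup (W i)] [∀ i, Module K (W i)] {F : X.carrier → ∀ i, W i} {x : X.carrier}
    (hF : ∀ i, X.RegularVec (fun y => F y i) x) : X.RegularVec F x := by
  classical
  intro l
  have h : ∀ w : ∀ i, W i, l w = ∑ i, (l ∘ₗ LinearMap.single K W i) (w i) := by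
    intro w
    conv_lhs => rw [← Finset.univ_sum_single w, map_sum]
    rfl
  simp only [h]
  exact hX.sum _ fun i _ => hF i _

/-- Polynomial functions of regular vectors are regular. -/
theorem RegularVec.polyFunctions_comp (hX : X.IsGeometric) {F : X.carrier → W} {x : X.carrier}
    (hF : X.RegularVec F x) {P : W → K} (hP : P ∈ polyFunctions K W) :
    X.RegularAt (fun y => P (F y)) x := by
  induction hP using Algebra.adjoin_induction with
  | mem P hP =>
    obtain ⟨l, rfl⟩ := hP
    exact hF l
  | algebraMap c => exact hX.const c x
  | add P Q _ _ hP hQ => exact hX.add hP hQ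
  | mul P Q _ _ hP hQ => exact hX.mul hP hQ

/-- Expansion in a basis turns each coordinate of the value into a polynomial in the coordinates of
the arguments. The main use is with the wedge product: a regular frame has regular Plücker
coordinates. -/
theorem RegularVec.multilinear (hX : X.IsGeometric) [FiniteDimensional K V] {ι : Type*}
    [Fintype ι] (f : MultilinearMap K (fun _ : ι => V) W) {F : ι → X.carrier → V} {x : X.carrier}
    (hF : ∀ i, X.RegularVec (F i) x) : X.RegularVec (fun y => f fun i => F i y) x := by
  classical
  intro l
  let b := Module.finBasis K V
  have h : ∀ y, l (f fun i => F i y) =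
      ∑ r : ι → Fin (Module.finrank K V), (∏ i, b.coord (r i) (F i y)) * l (f fun i => b (r i)) := by
    intro y
    have h1 : (fun i => F i y) = fun i => ∑ k, b.coord k (F i y) • b k := by
      ext1 i
      exact (b.sum_repr (F i y)).symm
    rw [h1, MultilinearMap.map_sum, map_sum]
    refine Finset.sum_congr rfl fun r _ => ?_
    rw [MultilinearMap.map_smul_univ, map_smul, smul_eq_mul]
  simp only [h]
  exact hX.sum _ fun r _ => hX.mul (hX.prod _ fun i _ => hF i _) (hX.const _ x)

end RegularVec

section Standard

variable {K : Type*} [Field K]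

theorem isGeometric_affineSpace (n : ℕ) : (affineSpace K n).IsGeometric :=
  isGeometric_ofForms (isFormFamily_polyFunctions _)

theorem regularVec_affineSpace (n : ℕ) (x : (affineSpace K n).carrier) :
    (affineSpace K n).RegularVec (W := Fin n → K) (fun y => y) x := by
  intro l
  have := regularAt_ofForms_div (K := K) (rep := (id : (Fin n → K) → Fin n → K))
    (form := fun _ : Unit => (polyFunctions K (Fin n → K) : Set ((Fin n → K) → K))) (d := ())
    (dual_mem_polyFunctions l) (one_mem (polyFunctions K (Fin n → K))) (x := x) (by simp)
  exact (isGeometric_affineSpace n).congr this (Eventually.of_forall fun y => div_one _)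

theorem isMorphism_affineSpace {n : ℕ} {Z : SpaceWithFunctions K} (hZ : Z.IsGeometric)
    {φ : Z.carrier → (affineSpace K n).carrier}
    (h : ∀ z, Z.RegularVec (W := Fin n → K) φ z) :
    IsMorphism (X := Z) (Y := affineSpace K n) φ :=
  isMorphism_ofForms hZ fun z => ⟨φ, fun _ _ hP => (h z).polyFunctions_comp hZ hP,
    Eventually.of_forall fun _ _ => ⟨1, one_ne_zero, fun _ _ => (one_mul _).symm⟩⟩

section Projective

variable {W W' : Type*} [AddCommGroup W] [Module K W] [AddCommGroup W'] [Module K W']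

theorem isGeometric_projectiveSpace : (projectiveSpace K W).IsGeometric :=
  isGeometric_ofForms (isFormFamily_homogeneousForms W)

/-- The chosen representative of a point is not regular by itself. Dividing by a linear form removes
the arbitrary scalar and leaves quotients of linear forms. -/
theorem regularVec_projectiveSpace (L : W →ₗ[K] W') (δ : Module.Dual K W)
    {p : Projectivization K W} (hp : δ p.rep ≠ 0) :
    (projectiveSpace K W).RegularVec
      (fun q : Projectivization K W => (δ q.rep)⁻¹ • L q.rep) p := by
  intro l
  have := regularAt_ofForms_div (K := K) (rep := (Projectivization.rep : Projectivization K W → W))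
    (form := homogeneousForms K W) (dual_mem_homogeneousForms (l ∘ₗ L))
    (dual_mem_homogeneousForms δ) (x := p) hp
  refine isGeometric_projectiveSpace.congr this (Eventually.of_forall fun q => ?_)
  simp [div_eq_inv_mul]

theorem isMorphism_projectiveSpace {Z : SpaceWithFunctions K} (hZ : Z.IsGeometric)
    {φ : Z.carrier → Projectivization K W}
    (h : ∀ z, ∃ F : Z.carrier → W, Z.RegularVec F z ∧
      ∀ᶠ y in 𝓝 z, ∃ c : K, c ≠ 0 ∧ (φ y).rep = c • F y) :
    IsMorphism (X := Z) (Y := projectiveSpace K W) φ := by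
  refine isMorphism_ofForms hZ fun z => ?_
  obtain ⟨F, hF, hc⟩ := h z
  refine ⟨F, fun d P hP => hF.polyFunctions_comp hZ hP.1, hc.mono fun y ⟨c, hc0, hy⟩ d =>
    ⟨c ^ d, pow_ne_zero d hc0, fun P hP => ?_⟩⟩
  rw [hy, hP.2]

end Projective

section Multiprojective

variable {ι : Type*} [Fintype ι] {W : ι → Type*} [∀ i, AddCommGroup (W i)] [∀ i, Module K (W i)]
  {W' : Type*} [AddCommGroup W'] [Module K W']

theorem isGeometric_multiprojectiveSpace : (multiprojectiveSpace K W).IsGeometric :=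
  isGeometric_ofForms (isFormFamily_multihomogeneousForms W)

theorem regularVec_multiprojectiveSpace (i : ι) (L : W i →ₗ[K] W') (δ : Module.Dual K (W i))
    {p : ∀ i, Projectivization K (W i)} (hp : δ (p i).rep ≠ 0) :
    (multiprojectiveSpace K W).RegularVec
      (fun q : ∀ i, Projectivization K (W i) => (δ (q i).rep)⁻¹ • L (q i).rep) p := by
  classical
  intro l
  have := regularAt_ofForms_div (K := K)
    (rep := (fun p i => (p i).rep : (∀ i, Projectivization K (W i)) → ∀ i, W i))
    (form := multihomogeneousForms K W) (dual_proj_mem_multihomogeneousForms i (l ∘ₗ L))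
    (dual_proj_mem_multihomogeneousForms i δ) (x := p) hp
  refine isGeometric_multiprojectiveSpace.congr this (Eventually.of_forall fun q => ?_)
  simp [div_eq_inv_mul]

theorem isMorphism_multiprojectiveSpace {Z : SpaceWithFunctions K} (hZ : Z.IsGeometric)
    {φ : Z.carrier → ∀ i, Projectivization K (W i)}
    (h : ∀ z i, ∃ F : Z.carrier → W i, Z.RegularVec F z ∧
      ∀ᶠ y in 𝓝 z, ∃ c : K, c ≠ 0 ∧ (φ y i).rep = c • F y) :
    IsMorphism (X := Z) (Y := multiprojectiveSpace K W) φ := by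
  refine isMorphism_ofForms hZ fun z => ?_
  choose F hF hc using h z
  refine ⟨fun y i => F i y, fun d P hP => (RegularVec.pi hZ hF).polyFunctions_comp hZ hP.1, ?_⟩
  filter_upwards [eventually_all.2 hc] with y hy d
  choose c hc0 hy using hy
  refine ⟨∏ i, c i ^ d i, Finset.prod_ne_zero_iff.2 fun i _ => pow_ne_zero _ (hc0 i),
    fun P hP => ?_⟩
  rw [← hP.2]
  exact congrArg P (funext hy)

end Multiprojective

end Standard

end SpaceWithFunctions

/-! ### Plücker coordinates, Cramer's rule and closedness of the Plücker embedding. -/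

section Plucker

open Module

variable {K V : Type*} [Field K] [AddCommGroup V] [Module K V] {t : ℕ}

/-- The linear form `v₁ ∧ ⋯ ∧ v_t ↦ det (π v_i)`. -/
noncomputable def pluckerDet (π : V →ₗ[K] Fin t → K) : Dual K (⋀[K]^t V) :=
  exteriorPower.alternatingMapLinearEquiv (Matrix.detRowAlternating.compLinearMap π)

theorem pluckerDet_ιMulti (π : V →ₗ[K] Fin t → K) (v : Fin t → V) :
    pluckerDet π (exteriorPower.ιMulti K t v) = Matrix.det (Matrix.of fun i => π (v i)) := by
  rw [pluckerDet, exteriorPower.alternatingMapLinearEquiv_apply_ιMulti]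
  rfl

/-- Replace the `i`-th coordinate of `π` by the linear form `l`. -/
def replaceCoord (π : V →ₗ[K] Fin t → K) (i : Fin t) (l : Dual K V) : V →ₗ[K] Fin t → K :=
  LinearMap.pi (Function.update (fun j => LinearMap.proj j ∘ₗ π) i l)

/-- The vectors `b_i(ω)` given by Cramer's rule: on `⋀ᵗ U` they are, up to a common factor, the
basis of `U` dual to `π`. -/
noncomputable def cramerVec [FiniteDimensional K V] (π : V →ₗ[K] Fin t → K) (i : Fin t) :
    ⋀[K]^t V →ₗ[K] V :=
  ∑ m, (pluckerDet (replaceCoord π i ((finBasis K V).coord m))).smulRight (finBasis K V m)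

/-- For a frame dual to `π` the matrix is the identity with column `i` replaced, so its determinant
is the `i`-th entry of the new column. This is why linear forms in Plücker coordinates recover the
frame. -/
theorem det_one_replaceCoord (π : V →ₗ[K] Fin t → K) {v : Fin t → V}
    (hv : ∀ k, π (v k) = Pi.single k 1) (i : Fin t) (l : Dual K V) :
    pluckerDet (replaceCoord π i l) (exteriorPower.ιMulti K t v) = l (v i) := by
  have h : (Matrix.of fun k => replaceCoord π i l (v k)) =
      (1 : Matrix (Fin t) (Fin t) K).updateCol i fun k => l (v k) := by
    ext k j
    rcases eq_or_ne j i with rfl | hj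
    · simp [replaceCoord]
    · simp [replaceCoord, hj, hv, Matrix.one_apply, Pi.single_apply, eq_comm]
  rw [pluckerDet_ιMulti, h, ← Matrix.cramer_apply, Matrix.cramer_one]
  rfl

theorem pluckerDet_ιMulti_dual (π : V →ₗ[K] Fin t → K) {v : Fin t → V}
    (hv : ∀ k, π (v k) = Pi.single k 1) : pluckerDet π (exteriorPower.ιMulti K t v) = 1 := by
  have h : (Matrix.of fun k => π (v k)) = (1 : Matrix (Fin t) (Fin t) K) := by
    ext k j
    simp [hv, Matrix.one_apply, Pi.single_apply, eq_comm]
  rw [pluckerDet_ιMulti, h, Matrix.det_one]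

theorem cramerVec_ιMulti_dual [FiniteDimensional K V] (π : V →ₗ[K] Fin t → K) {v : Fin t → V}
    (hv : ∀ k, π (v k) = Pi.single k 1) (i : Fin t) :
    cramerVec π i (exteriorPower.ιMulti K t v) = v i := by
  rw [cramerVec, LinearMap.sum_apply]
  simp only [LinearMap.smulRight_apply, det_one_replaceCoord π hv]
  exact (finBasis K V).sum_repr (v i)

theorem linearIndependent_of_dual (π : V →ₗ[K] Fin t → K) {v : Fin t → V}
    (hv : ∀ k, π (v k) = Pi.single k 1) : LinearIndependent K v := by
  refine LinearIndependent.of_comp π ?_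
  have : (π ∘ v) = Pi.basisFun K (Fin t) := by
    ext1 k
    simp [hv]
  rw [this]
  exact (Pi.basisFun K (Fin t)).linearIndependent

theorem exists_dual_of_linearIndependent {v : Fin t → V} (hv : LinearIndependent K v) :
    ∃ π : V →ₗ[K] Fin t → K, ∀ k, π (v k) = Pi.single k 1 := by
  obtain ⟨π, hπ⟩ := LinearMap.exists_leftInverse_of_injective (Fintype.linearCombination K v)
    (linearIndependent_iff_injective_fintypeLinearCombination.1 hv |> LinearMap.ker_eq_bot.2)
  refine ⟨π, fun k => ?_⟩
  have := LinearMap.congr_fun hπ (Pi.single k 1)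
  simpa using this

theorem ιMulti_ne_zero {v : Fin t → V} (hv : LinearIndependent K v) :
    exteriorPower.ιMulti K t v ≠ 0 := by
  obtain ⟨π, hπ⟩ := exists_dual_of_linearIndependent hv
  intro h
  have := pluckerDet_ιMulti_dual π hπ
  rw [h, map_zero] at this
  exact zero_ne_one this

theorem span_range_eq_of_finrank [FiniteDimensional K V] {U : Submodule K V} (hU : finrank K U = t)
    {v : Fin t → V} (hv : LinearIndependent K v) (hvU : ∀ k, v k ∈ U) :
    Submodule.span K (Set.range v) = U :=
  Submodule.eq_of_le_of_finrank_eq (Submodule.span_le.2 (Set.range_subset_iff.2 hvU))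
    (by rw [finrank_span_eq_card hv, Fintype.card_fin, hU])

theorem exists_frame [FiniteDimensional K V] {U : Submodule K V} (hU : finrank K U = t) :
    ∃ v : Fin t → V, LinearIndependent K v ∧ Submodule.span K (Set.range v) = U := by
  let b := finBasisOfFinrankEq K U hU
  have hv : LinearIndependent K fun k => (b k : V) :=
    b.linearIndependent.map' U.subtype U.ker_subtype
  exact ⟨_, hv, span_range_eq_of_finrank hU hv fun k => (b k).2⟩

theorem exists_dual_frame_of_linearIndependent [FiniteDimensional K V] {U : Submodule K V}
    (hU : finrank K U = t) (π : V →ₗ[K] Fin t → K) {v : Fin t → V} (hvU : ∀ k, v k ∈ U)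
    (hv : LinearIndependent K (π ∘ v)) :
    ∃ w : Fin t → V, (∀ k, π (w k) = Pi.single k 1) ∧ Submodule.span K (Set.range w) = U := by
  have hspan : Submodule.map π U = ⊤ := by
    refine top_le_iff.1 ?_
    rw [← hv.span_eq_top_of_card_eq_finrank' (by simp), Submodule.span_le]
    rintro _ ⟨k, rfl⟩
    exact ⟨v k, hvU k, rfl⟩
  have : ∀ k, ∃ w ∈ U, π w = Pi.single k 1 := fun k =>
    (hspan ▸ Submodule.mem_top : Pi.single k 1 ∈ Submodule.map π U)
  choose w hwU hw using this
  exact ⟨w, hw, span_range_eq_of_finrank hU (linearIndependent_of_dual π hw) hwU⟩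

variable [FiniteDimensional K V]

theorem rep_pluckerPoint (U : {U : Submodule K V // finrank K U = t}) {v : Fin t → V}
    (hv : LinearIndependent K v) (hvU : Submodule.span K (Set.range v) = U.1) :
    ∃ c : K, c ≠ 0 ∧ (pluckerPoint U).rep = c • exteriorPower.ιMulti K t v := by
  have hmem : exteriorPower.ιMulti K t v ∈ (pluckerPoint U).submodule := by
    rw [pluckerPoint, Projectivization.submodule_mk'']
    have hk : ∀ k, v k ∈ U.1 := fun k => hvU ▸ Submodule.subset_span ⟨k, rfl⟩
    exact ⟨exteriorPower.ιMulti K t fun k => ⟨v k, hk k⟩, by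
      rw [exteriorPower.map_apply_ιMulti]
      rfl⟩
  rw [Projectivization.submodule_eq, Submodule.mem_span_singleton] at hmem
  obtain ⟨a, ha⟩ := hmem
  have ha0 : a ≠ 0 := by
    rintro rfl
    exact ιMulti_ne_zero hv (by rw [← ha, zero_smul])
  exact ⟨a⁻¹, inv_ne_zero ha0, by rw [← ha, smul_smul, inv_mul_cancel₀ ha0, one_smul]⟩

theorem pluckerPoint_eq_of_rep (U : {U : Submodule K V // finrank K U = t})
    {p : Projectivization K (⋀[K]^t V)} {v : Fin t → V}
    (hv : LinearIndependent K v) (hvU : Submodule.span K (Set.range v) = U.1) {a : K}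
    (hp : p.rep = a • exteriorPower.ιMulti K t v) : pluckerPoint U = p := by
  obtain ⟨c, hc, h⟩ := rep_pluckerPoint U hv hvU
  rw [← Projectivization.mk_rep (pluckerPoint U), ← Projectivization.mk_rep p,
    Projectivization.mk_eq_mk_iff']
  have ha : a ≠ 0 := by
    rintro rfl
    exact p.rep_nonzero (by rw [hp, zero_smul])
  exact ⟨c / a, by rw [h, hp, smul_smul, div_mul_cancel₀ _ ha]⟩

/-- The basis of `U` dual to `π`, computed from the Plücker coordinates `ω` of `U`. -/
noncomputable def dualFrame (π : V →ₗ[K] Fin t → K) (ω : ⋀[K]^t V) (i : Fin t) : V :=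
  (pluckerDet π ω)⁻¹ • cramerVec π i ω

/-- `cramerVec` and `pluckerDet` are both linear in `ω`, so the unknown scalar between the chosen
representative and the wedge of `v` cancels in `dualFrame`. -/
theorem dualFrame_eq (U : {U : Submodule K V // finrank K U = t}) (π : V →ₗ[K] Fin t → K)
    {v : Fin t → V} (hv : ∀ k, π (v k) = Pi.single k 1)
    (hvU : Submodule.span K (Set.range v) = U.1) :
    pluckerDet π (pluckerPoint U).rep ≠ 0 ∧ dualFrame π (pluckerPoint U).rep = v ∧
      (pluckerPoint U).rep = pluckerDet π (pluckerPoint U).rep • exteriorPower.ιMulti K t v := by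
  obtain ⟨c, hc, h⟩ := rep_pluckerPoint U (linearIndependent_of_dual π hv) hvU
  have hd : pluckerDet π (pluckerPoint U).rep = c := by
    rw [h, map_smul, pluckerDet_ιMulti_dual π hv, smul_eq_mul, mul_one]
  refine ⟨hd ▸ hc, ?_, by rw [hd, h]⟩
  ext1 i
  rw [dualFrame, hd, h, map_smul, cramerVec_ιMulti_dual π hv, smul_smul, inv_mul_cancel₀ hc,
    one_smul]

/-- A nonzero minor means that `π` restricts to an isomorphism from `U` onto `K ^ t`; the frame is
the preimage of the standard basis. -/
theorem exists_dual_frame (U : {U : Submodule K V // finrank K U = t}) (π : V →ₗ[K] Fin t → K)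
    (h : pluckerDet π (pluckerPoint U).rep ≠ 0) :
    ∃ w : Fin t → V, (∀ k, π (w k) = Pi.single k 1) ∧ Submodule.span K (Set.range w) = U.1 := by
  obtain ⟨v, hv, hvU⟩ := exists_frame U.2
  obtain ⟨c, hc, hr⟩ := rep_pluckerPoint U hv hvU
  refine exists_dual_frame_of_linearIndependent U.2 π (v := v)
    (fun k => hvU ▸ Submodule.subset_span ⟨k, rfl⟩) ?_
  rw [hr, map_smul, pluckerDet_ιMulti, smul_eq_mul] at h
  exact Matrix.linearIndependent_rows_of_det_ne_zero (right_ne_zero_of_mul h)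

theorem dualFrame_spec (U : {U : Submodule K V // finrank K U = t}) (π : V →ₗ[K] Fin t → K)
    (h : pluckerDet π (pluckerPoint U).rep ≠ 0) :
    (∀ k, π (dualFrame π (pluckerPoint U).rep k) = Pi.single k 1) ∧
    Submodule.span K (Set.range (dualFrame π (pluckerPoint U).rep)) = U.1 := by
  obtain ⟨w, hw, hwU⟩ := exists_dual_frame U π h
  rw [(dualFrame_eq U π hw hwU).2.1]
  exact ⟨hw, hwU⟩

theorem exists_pluckerDet_ne_zero (U : {U : Submodule K V // finrank K U = t}) :
    ∃ π : V →ₗ[K] Fin t → K, pluckerDet π (pluckerPoint U).rep ≠ 0 := by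
  obtain ⟨v, hv, hvU⟩ := exists_frame U.2
  obtain ⟨π, hπ⟩ := exists_dual_of_linearIndependent hv
  exact ⟨π, (dualFrame_eq U π hπ hvU).1⟩

theorem pluckerPoint_injective :
    Function.Injective (pluckerPoint : {U : Submodule K V // finrank K U = t} → _) := by
  intro U U' h
  obtain ⟨π, hπ⟩ := exists_pluckerDet_ne_zero U
  exact Subtype.ext ((dualFrame_spec U π hπ).2.symm.trans
    (h ▸ (dualFrame_spec U' π (h ▸ hπ)).2))

/-- When `π` consists of `t` of the coordinate forms of a basis, `pluckerDet π` is a coordinate form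
of the induced basis of `⋀[K]^t V`, and some coordinate of `ω` is nonzero. Here `ω` need not be
decomposable, so these minors cover all of projective space. -/
theorem exists_pluckerDet_ne_zero_of_ne_zero {ω : ⋀[K]^t V} (hω : ω ≠ 0) :
    ∃ π : V →ₗ[K] Fin t → K, pluckerDet π ω ≠ 0 := by
  by_contra! h
  let b := finBasis K V
  refine hω ((b.exteriorPower t).ext_elem fun s => ?_)
  have hs : exteriorPower.ιMultiDual K t b s =
      pluckerDet (LinearMap.pi fun i => b.coord (Set.powersetCard.ofFinEmbEquiv.symm s i)) := by
    refine exteriorPower.linearMap_ext ?_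
    ext v
    rw [LinearMap.compAlternatingMap_apply, LinearMap.compAlternatingMap_apply, pluckerDet_ιMulti,
      exteriorPower.ιMultiDual_apply_ιMulti]
    rfl
  have h1 := h (LinearMap.pi fun i => b.coord (Set.powersetCard.ofFinEmbEquiv.symm s i))
  rw [← hs] at h1
  rw [map_zero, Finsupp.zero_apply, ← h1, exteriorPower.basis_repr_apply]

open Filter Topology SpaceWithFunctions in
/-- The Plücker embedding has closed image. -/
theorem isClosed_range_pluckerPoint :
    IsClosed (X := (projectiveSpace K (⋀[K]^t V)).carrier)
      (Set.range (pluckerPoint : {U : Submodule K V // finrank K U = t} → _)) := by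
  refine isOpen_compl_iff.1 (isOpen_iff_mem_nhds.2 fun p hp => ?_)
  change Projectivization K (⋀[K]^t V) at p
  obtain ⟨π, hπ⟩ := exists_pluckerDet_ne_zero_of_ne_zero p.rep_nonzero
  have hX := isGeometric_projectiveSpace (K := K) (W := ⋀[K]^t V)
  have hG := regularVec_projectiveSpace LinearMap.id (pluckerDet π) hπ
  have hF := RegularVec.multilinear hX (exteriorPower.ιMulti K t (M := V)).toMultilinearMap
    fun i => regularVec_projectiveSpace (cramerVec π i) (pluckerDet π) hπ
  -- Where the minor of `π` is nonzero, a point is a Plücker point exactly when its normalized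
  -- representative is the wedge of the frame that Cramer's rule attaches to it. Both sides are
  -- regular, so failure of this equation is an open condition.
  have hne : exteriorPower.ιMulti K t (dualFrame π p.rep) ≠
      (pluckerDet π p.rep)⁻¹ • p.rep := by
    intro h
    have h' : p.rep = pluckerDet π p.rep • exteriorPower.ιMulti K t (dualFrame π p.rep) := by
      rw [h, smul_smul, mul_inv_cancel₀ hπ, one_smul]
    have hli : LinearIndependent K (dualFrame π p.rep) := by
      by_contra hdep
      rw [AlternatingMap.map_linearDependent _ _ hdep, smul_zero] at h'
      exact p.rep_nonzero h'
    exact hp ⟨⟨_, (finrank_span_eq_card hli).trans (Fintype.card_fin t)⟩,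
      pluckerPoint_eq_of_rep _ hli rfl h'⟩
  obtain ⟨l, hl⟩ : ∃ l : Dual K (⋀[K]^t V), l (exteriorPower.ιMulti K t (dualFrame π p.rep)) -
      l ((pluckerDet π p.rep)⁻¹ • p.rep) ≠ 0 := by
    by_contra! h
    exact hne (Module.forall_dual_apply_eq_zero_iff K _ |>.1 (fun l => by
      rw [map_sub]; exact h l) |> sub_eq_zero.1)
  have hreg := hX.add (hF l) (hX.mul (hX.const (-1) p) (hG l))
  have hδ := hX.ne_zero (f := fun q : Projectivization K (⋀[K]^t V) =>
    l (exteriorPower.ιMulti K t (dualFrame π q.rep)) +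
      -1 * l ((pluckerDet π q.rep)⁻¹ • q.rep)) hreg
    (by rw [neg_one_mul, ← sub_eq_add_neg]; exact hl)
  have hd : ∀ᶠ q : (projectiveSpace K (⋀[K]^t V)).carrier in 𝓝 p,
      pluckerDet π (Projectivization.rep q) ≠ 0 :=
    eventually_ofForms_ne_zero (dual_mem_homogeneousForms (pluckerDet π)) hπ
  filter_upwards [hδ, hd] with q hq hq'
  rintro ⟨U, rfl⟩
  obtain ⟨w, hw, hwU⟩ := exists_dual_frame U π hq'
  obtain ⟨-, h2, h3⟩ := dualFrame_eq U π hw hwU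
  apply hq
  rw [h2, neg_one_mul, ← sub_eq_add_neg, sub_eq_zero]
  nth_rw 2 [h3]
  rw [smul_smul, inv_mul_cancel₀ hq', one_smul]

end Plucker

/-! ### The Zariski topology of affine space: irreducibility and dimension. -/

namespace SpaceWithFunctions

theorem isTopologicalBasis_ofForms {K X A D : Type*} [Field K] [AddCommMonoid D] {rep : X → A}
    {form : D → Set (A → K)} (hform : IsFormFamily form) :
    TopologicalSpace.IsTopologicalBasis (α := (ofForms rep form).carrier)
      {U | ∃ d, ∃ P ∈ form d, U = {x | P (rep x) ≠ 0}} where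
  exists_subset_inter := by
    rintro _ ⟨d, P, hP, rfl⟩ _ ⟨d', Q, hQ, rfl⟩ x ⟨hxP, hxQ⟩
    exact ⟨_, ⟨_, _, hform.mul hP hQ, rfl⟩, mul_ne_zero hxP hxQ,
      fun y hy => ⟨left_ne_zero_of_mul hy, right_ne_zero_of_mul hy⟩⟩
  sUnion_eq := Set.eq_univ_of_forall fun x =>
    ⟨_, ⟨0, _, hform.one, rfl⟩, show (1 : K) ≠ 0 from one_ne_zero⟩
  eq_generateFrom := rfl

end SpaceWithFunctions

section Affine

open MvPolynomial SpaceWithFunctions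

variable {K : Type*} [Field K] {n : ℕ}

/-- The bridge from coordinate-free polynomial functions to the polynomial ring, where the
Nullstellensatz and the dimension formula live. -/
theorem mem_polyFunctions_iff {P : (Fin n → K) → K} :
    P ∈ polyFunctions K (Fin n → K) ↔ ∃ p : MvPolynomial (Fin n) K, P = fun x => aeval x p := by
  constructor
  · intro hP
    induction hP using Algebra.adjoin_induction with
    | mem P hP =>
      obtain ⟨l, rfl⟩ := hP
      refine ⟨∑ i, C (l (Pi.single i 1)) * X i, ?_⟩
      ext x
      change l x = _
      conv_lhs => rw [← Finset.univ_sum_single x, map_sum]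
      rw [map_sum]
      refine Finset.sum_congr rfl fun i _ => ?_
      have hi : (Pi.single i (x i) : Fin n → K) = x i • Pi.single i 1 := by
        rw [← Pi.single_smul, smul_eq_mul, mul_one]
      rw [map_mul, aeval_X, algHom_C, Algebra.algebraMap_self_apply, hi, map_smul, smul_eq_mul,
        mul_comm]
    | algebraMap c => exact ⟨C c, by ext x; simp⟩
    | add P Q _ _ hP hQ =>
      obtain ⟨p, rfl⟩ := hP
      obtain ⟨q, rfl⟩ := hQ
      exact ⟨p + q, by ext x; simp⟩
    | mul P Q _ _ hP hQ =>
      obtain ⟨p, rfl⟩ := hP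
      obtain ⟨q, rfl⟩ := hQ
      exact ⟨p * q, by ext x; simp⟩
  · rintro ⟨p, rfl⟩
    induction p using MvPolynomial.induction_on with
    | C c =>
      convert (polyFunctions K (Fin n → K)).algebraMap_mem c using 1
      ext x
      simp
    | add p q hp hq =>
      simp only [map_add]
      exact add_mem (S := Subalgebra K ((Fin n → K) → K)) hp hq
    | mul_X p i hp =>
      simp only [map_mul, aeval_X]
      exact mul_mem (S := Subalgebra K ((Fin n → K) → K)) hp
        (dual_mem_polyFunctions (LinearMap.proj i : (Fin n → K) →ₗ[K] K))

theorem isTopologicalBasis_affineSpace :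
    TopologicalSpace.IsTopologicalBasis (α := (affineSpace K n).carrier)
      (Set.range fun p : MvPolynomial (Fin n) K => {x : Fin n → K | aeval x p ≠ 0}) := by
  have h := isTopologicalBasis_ofForms (rep := (id : (Fin n → K) → Fin n → K))
    (isFormFamily_polyFunctions (K := K) (Fin n → K))
  refine Eq.subst (motive := TopologicalSpace.IsTopologicalBasis
    (α := (affineSpace K n).carrier)) (Set.ext fun U => ⟨?_, ?_⟩) h
  rotate_left
  · rintro ⟨p, rfl⟩
    exact ⟨(), _, mem_polyFunctions_iff.2 ⟨p, rfl⟩, rfl⟩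
  · rintro ⟨-, P, hP, rfl⟩
    obtain ⟨p, rfl⟩ := mem_polyFunctions_iff.1 hP
    exact ⟨p, rfl⟩

theorem isOpen_aeval_ne_zero (p : MvPolynomial (Fin n) K) :
    IsOpen (X := (affineSpace K n).carrier) {x : Fin n → K | aeval x p ≠ 0} :=
  isTopologicalBasis_affineSpace.isOpen ⟨p, rfl⟩

instance irreducibleSpace_affineSpace [Infinite K] : IrreducibleSpace (affineSpace K n).carrier where
  isPreirreducible_univ := by
    rintro U V hU hV ⟨x, -, hx⟩ ⟨y, -, hy⟩
    obtain ⟨_, ⟨p, rfl⟩, hxp, hpU⟩ :=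
      isTopologicalBasis_affineSpace.exists_subset_of_mem_open hx hU
    obtain ⟨_, ⟨q, rfl⟩, hyq, hqV⟩ :=
      isTopologicalBasis_affineSpace.exists_subset_of_mem_open hy hV
    have hp : p ≠ 0 := fun h => hxp (by rw [h, map_zero])
    have hq : q ≠ 0 := fun h => hyq (by rw [h, map_zero])
    have : ∃ z : Fin n → K, aeval z (p * q) ≠ 0 := by
      by_contra! h
      exact mul_ne_zero hp hq (MvPolynomial.funext fun z => by
        rw [map_zero]; exact (coe_aeval_eq_eval z ▸ h z))
    obtain ⟨z, hz⟩ := this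
    rw [map_mul] at hz
    exact ⟨z, trivial, hpU (left_ne_zero_of_mul hz), hqV (right_ne_zero_of_mul hz)⟩
  toNonempty := ⟨(0 : Fin n → K)⟩

theorem isClosed_zeroLocus (I : Ideal (MvPolynomial (Fin n) K)) :
    IsClosed (X := (affineSpace K n).carrier) (zeroLocus K I) := by
  refine isOpen_compl_iff.1 (isOpen_iff_mem_nhds.2 fun x hx => ?_)
  obtain ⟨p, hp, hpx⟩ : ∃ p ∈ I, aeval (x : Fin n → K) p ≠ 0 := by
    by_contra! h
    exact hx h
  exact Filter.mem_of_superset ((isOpen_aeval_ne_zero p).mem_nhds hpx) fun y hy hyI => hy (hyI p hp)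

theorem zeroLocus_vanishingIdeal_of_isClosed {Z : Set (affineSpace K n).carrier}
    (hZ : IsClosed Z) : zeroLocus K (vanishingIdeal K (Z : Set (Fin n → K))) = Z := by
  refine (zeroLocus_vanishingIdeal_le _).antisymm' fun x hx => ?_
  by_contra hxZ
  obtain ⟨_, ⟨p, rfl⟩, hxp, hp⟩ :=
    isTopologicalBasis_affineSpace.exists_subset_of_mem_open (show x ∈ Zᶜ from hxZ) hZ.isOpen_compl
  exact hxp (hx p fun z hz => by_contra fun h => hp h hz)

theorem isPrime_vanishingIdeal {Z : Set (affineSpace K n).carrier} (hZ : IsIrreducible Z) :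
    (vanishingIdeal K (Z : Set (Fin n → K))).IsPrime where
  ne_top' := by
    obtain ⟨z, hz⟩ := hZ.nonempty
    intro h
    have h1 := (Ideal.eq_top_iff_one _).1 h z hz
    rw [map_one] at h1
    exact one_ne_zero h1
  mem_or_mem' := by
    intro p q hpq
    by_contra! h
    obtain ⟨⟨x, hx, hxp⟩, y, hy, hyq⟩ : (∃ x ∈ Z, aeval (x : Fin n → K) p ≠ 0) ∧
        ∃ x ∈ Z, aeval (x : Fin n → K) q ≠ 0 := by
      constructor
      · by_contra! hp
        exact h.1 hp
      · by_contra! hq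
        exact h.2 hq
    obtain ⟨z, hz, hzp, hzq⟩ := hZ.2 _ _ (isOpen_aeval_ne_zero p) (isOpen_aeval_ne_zero q)
      ⟨x, hx, hxp⟩ ⟨y, hy, hyq⟩
    have := hpq z hz
    rw [map_mul] at this
    exact mul_ne_zero hzp hzq this

theorem isIrreducible_zeroLocus [IsAlgClosed K] (P : Ideal (MvPolynomial (Fin n) K))
    [hP : P.IsPrime] : IsIrreducible (X := (affineSpace K n).carrier) (zeroLocus K P) := by
  have hI : vanishingIdeal K (zeroLocus K P) = P := IsPrime.vanishingIdeal_zeroLocus P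
  constructor
  · refine Set.nonempty_iff_ne_empty.2 fun h => ?_
    have h : zeroLocus K P = ∅ := h
    rw [h] at hI
    exact hP.ne_top (hI ▸ vanishingIdeal_empty)
  · rintro U V hU hV ⟨x, hxP, hx⟩ ⟨y, hyP, hy⟩
    obtain ⟨_, ⟨p, rfl⟩, hxp, hpU⟩ :=
      isTopologicalBasis_affineSpace.exists_subset_of_mem_open hx hU
    obtain ⟨_, ⟨q, rfl⟩, hyq, hqV⟩ :=
      isTopologicalBasis_affineSpace.exists_subset_of_mem_open hy hV
    have : p * q ∉ vanishingIdeal K (zeroLocus K P) := by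
      rw [hI]
      exact hP.mul_notMem (fun h => hxp (hxP p h)) fun h => hyq (hyP q h)
    simp only [mem_vanishingIdeal_iff, not_forall] at this
    obtain ⟨z, hz, hzpq⟩ := this
    rw [map_mul] at hzpq
    exact ⟨z, hz, hpU (left_ne_zero_of_mul hzpq), hqV (right_ne_zero_of_mul hzpq)⟩

/-- By the Nullstellensatz, irreducible closed sets and prime ideals determine each other with
inclusions reversed. The two strictly monotone maps give the two inequalities with the Krull
dimension of the polynomial ring. -/
theorem topologicalKrullDim_affineSpace [IsAlgClosed K] :
    topologicalKrullDim (affineSpace K n).carrier = n := by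
  have hdim : Order.krullDim (PrimeSpectrum (MvPolynomial (Fin n) K))ᵒᵈ = n := by
    rw [Order.krullDim_orderDual]
    change ringKrullDim (MvPolynomial (Fin n) K) = n
    rw [MvPolynomial.ringKrullDim_of_isNoetherianRing, ringKrullDim_eq_zero_of_field, zero_add,
      Nat.card_fin]
  rw [← hdim]
  apply le_antisymm
  · refine Order.krullDim_le_of_strictMono (fun Z => OrderDual.toDual
      ⟨vanishingIdeal K (Z.carrier : Set (Fin n → K)), isPrime_vanishingIdeal Z.isIrreducible⟩) ?_
    refine Monotone.strictMono_of_injective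
      (fun Z Z' h => vanishingIdeal_anti_mono (SetLike.coe_subset_coe.2 h)) fun Z Z' h => ?_
    have h' : vanishingIdeal K (Z.carrier : Set (Fin n → K)) =
        vanishingIdeal K (Z'.carrier : Set (Fin n → K)) :=
      congrArg PrimeSpectrum.asIdeal (OrderDual.toDual.injective h)
    exact SetLike.coe_injective ((zeroLocus_vanishingIdeal_of_isClosed Z.isClosed).symm.trans
      ((congrArg (zeroLocus K) h').trans (zeroLocus_vanishingIdeal_of_isClosed Z'.isClosed)))
  · refine Order.krullDim_le_of_strictMono (fun P => ⟨zeroLocus K (OrderDual.ofDual P).asIdeal,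
      isIrreducible_zeroLocus _, isClosed_zeroLocus _⟩) ?_
    refine Monotone.strictMono_of_injective
      (fun P Q h => zeroLocus_anti_mono (K := K) (show (OrderDual.ofDual Q).asIdeal ≤ _ from h))
      fun P Q h => ?_
    have h' : zeroLocus K (OrderDual.ofDual P).asIdeal = zeroLocus K (OrderDual.ofDual Q).asIdeal :=
      congrArg TopologicalSpace.IrreducibleCloseds.carrier h
    apply OrderDual.ofDual.injective
    apply PrimeSpectrum.ext
    rw [← IsPrime.vanishingIdeal_zeroLocus (K := K) (OrderDual.ofDual P).asIdeal, h',
      IsPrime.vanishingIdeal_zeroLocus]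

end Affine

open TopologicalSpace in
/-- The Krull dimension can be computed on an open cover. -/
theorem topologicalKrullDim_le_of_forall_exists_isOpen {X : Type*} [TopologicalSpace X]
    {d : WithBot ℕ∞}
    (h : ∀ x : X, ∃ U : Set X, IsOpen U ∧ x ∈ U ∧ topologicalKrullDim U ≤ d) :
    topologicalKrullDim X ≤ d := by
  refine iSup_le fun p => ?_
  -- An open set around a point of the smallest member of the chain meets every member, and
  -- irreducible closed sets meeting an open set are determined by their traces on it. The whole
  -- chain thus restricts strictly.
  obtain ⟨x, hx⟩ := p.head.isIrreducible.nonempty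
  obtain ⟨U, hU, hxU, hd⟩ := h x
  refine le_trans ?_ hd
  let e := IrreducibleCloseds.orderIsoOfIsOpenEmbedding (Subtype.val : U → X)
    hU.isOpenEmbedding_subtypeVal
  have hmem : ∀ i, p i ∈ {Z : IrreducibleCloseds X | (Subtype.val ⁻¹' (Z : Set X) : Set U).Nonempty} :=
    fun i => ⟨⟨x, hxU⟩, LTSeries.head_le p i hx⟩
  let q : LTSeries (IrreducibleCloseds U) :=
    { length := p.length
      toFun := fun i => e.symm ⟨p i, hmem i⟩
      step := fun i => e.symm.strictMono (p.step i) }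
  exact Order.LTSeries.length_le_krullDim q

/-! ### Products of Grassmannians: frames, affine charts, rationality, dimension, irreducibility. -/

namespace SpaceWithFunctions

open Filter Topology Module

section General

variable {K : Type*} [Field K] {X Y : SpaceWithFunctions K}

theorem RegularVec.comp {W : Type*} [AddCommGroup W] [Module K W] {φ : X.carrier → Y.carrier}
    (hφ : IsMorphism (X := X) (Y := Y) φ) {F : Y.carrier → W} {x : X.carrier}
    (hF : Y.RegularVec F (φ x)) : X.RegularVec (fun z => F (φ z)) x :=
  fun l => hφ.2 x _ (hF l)

/-- Linear independence of regular vectors is an open condition. -/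
theorem eventually_linearIndependent (hX : X.IsGeometric) {V : Type*} [AddCommGroup V] [Module K V]
    [FiniteDimensional K V] {m : ℕ} {v : Fin m → X.carrier → V} {x : X.carrier}
    (hv : ∀ k, X.RegularVec (v k) x) (hx : LinearIndependent K fun k => v k x) :
    ∀ᶠ y in 𝓝 x, LinearIndependent K fun k => v k y := by
  -- Independence at `x` is witnessed by a minor equal to 1 there; the same minor is regular, stays
  -- nonzero nearby and forces independence.
  obtain ⟨π, hπ⟩ := exists_dual_of_linearIndependent hx
  have hreg := RegularVec.multilinear hX (exteriorPower.ιMulti K m (M := V)).toMultilinearMap hv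
    (pluckerDet π)
  have h1 := pluckerDet_ιMulti_dual π hπ
  filter_upwards [hX.ne_zero hreg (by
    rw [AlternatingMap.coe_multilinearMap, h1]; exact one_ne_zero)] with y hy
  by_contra hdep
  apply hy
  rw [AlternatingMap.coe_multilinearMap, AlternatingMap.map_linearDependent _ _ hdep, map_zero]

theorem isomorphic_subspace_univ (hX : X.IsGeometric) :
    X.Isomorphic (X.subspace Set.univ) :=
  ⟨(Equiv.Set.univ X.carrier).symm, isMorphism_induced_of_comp hX ⟨continuous_id, fun _ _ h => h⟩,
    isMorphism_induced⟩

end General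

section ProdGrassmannian

variable {K : Type*} [Field K] {ι : Type*} [Fintype ι] {e f : ι → ℕ}

theorem isGeometric_prodGrassmannian : (prodGrassmannian K e f).IsGeometric :=
  isGeometric_multiprojectiveSpace.induced

theorem regularVec_dualFrame_prodGrassmannian (i : ι)
    (π : (Fin (f i) → K) →ₗ[K] Fin (e i) → K)
    {y : ∀ i, {U : Submodule K (Fin (f i) → K) // finrank K U = e i}}
    (hy : pluckerDet π (pluckerPoint (y i)).rep ≠ 0) (k : Fin (e i)) :
    (prodGrassmannian K e f).RegularVec
      (fun z : ∀ i, {U : Submodule K (Fin (f i) → K) // finrank K U = e i} =>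
        dualFrame π (pluckerPoint (z i)).rep k) y :=
  RegularVec.comp (X := prodGrassmannian K e f) isMorphism_induced
    (regularVec_multiprojectiveSpace (W := fun i => ⋀[K]^(e i) (Fin (f i) → K)) i
      (cramerVec π k) (pluckerDet π) hy)

theorem eventually_pluckerDet_ne_zero_prodGrassmannian (i : ι)
    (π : (Fin (f i) → K) →ₗ[K] Fin (e i) → K)
    {y : ∀ i, {U : Submodule K (Fin (f i) → K) // finrank K U = e i}}
    (hy : pluckerDet π (pluckerPoint (y i)).rep ≠ 0) :
    ∀ᶠ z : (prodGrassmannian K e f).carrier in 𝓝 y,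
      pluckerDet π (pluckerPoint ((show ∀ i, {U : Submodule K (Fin (f i) → K) //
        finrank K U = e i} from z) i)).rep ≠ 0 := by
  classical
  have h := eventually_ofForms_ne_zero
    (rep := (fun p i => (p i).rep : (∀ i, Projectivization K (⋀[K]^(e i) (Fin (f i) → K))) → _))
    (dual_proj_mem_multihomogeneousForms (W := fun i => ⋀[K]^(e i) (Fin (f i) → K)) i
      (pluckerDet π)) (x := fun i => pluckerPoint (y i)) hy
  exact (continuous_induced (X := multiprojectiveSpace K _)
    (j := fun (U : ∀ i, {U : Submodule K (Fin (f i) → K) // finrank K U = e i}) i =>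
      pluckerPoint (U i))).continuousAt.eventually h

/-- Locally on a product of Grassmannians there are regular frames. -/
theorem exists_regular_frame_prodGrassmannian
    (y : ∀ i, {U : Submodule K (Fin (f i) → K) // finrank K U = e i}) (i : ι) :
    ∃ v : Fin (e i) → (prodGrassmannian K e f).carrier → Fin (f i) → K,
      (∀ k, (prodGrassmannian K e f).RegularVec (v k) y) ∧
      ∀ᶠ z : (prodGrassmannian K e f).carrier in 𝓝 y, LinearIndependent K (fun k => v k z) ∧
        Submodule.span K (Set.range fun k => v k z) =
          ((show ∀ i, {U : Submodule K (Fin (f i) → K) // finrank K U = e i} from z) i).1 := by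
  obtain ⟨π, hπ⟩ := exists_pluckerDet_ne_zero (y i)
  refine ⟨_, fun k => regularVec_dualFrame_prodGrassmannian i π hπ k, ?_⟩
  filter_upwards [eventually_pluckerDet_ne_zero_prodGrassmannian i π hπ] with z hz
  obtain ⟨h1, h2⟩ := dualFrame_spec _ π hz
  exact ⟨linearIndependent_of_dual π h1, h2⟩

/-- A map to a product of Grassmannians which locally has regular frames is a morphism. -/
theorem isMorphism_prodGrassmannian {Z : SpaceWithFunctions K} (hZ : Z.IsGeometric)
    {φ : Z.carrier → ∀ i, {U : Submodule K (Fin (f i) → K) // finrank K U = e i}}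
    (h : ∀ z i, ∃ v : Fin (e i) → Z.carrier → Fin (f i) → K, (∀ k, Z.RegularVec (v k) z) ∧
      ∀ᶠ y in 𝓝 z, LinearIndependent K (fun k => v k y) ∧
        Submodule.span K (Set.range fun k => v k y) = (φ y i).1) :
    IsMorphism (X := Z) (Y := prodGrassmannian K e f) φ := by
  refine isMorphism_induced_of_comp hZ (isMorphism_multiprojectiveSpace hZ fun z i => ?_)
  obtain ⟨v, hv, hφ⟩ := h z i
  exact ⟨_, RegularVec.multilinear hZ (exteriorPower.ιMulti K (e i)).toMultilinearMap hv,
    hφ.mono fun y hy => rep_pluckerPoint (φ y i) hy.1 hy.2⟩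

/-- The chart of a product of Grassmannians given by linear maps `π i`. -/
def chart (π : ∀ i, (Fin (f i) → K) →ₗ[K] Fin (e i) → K) : Set (prodGrassmannian K e f).carrier :=
  {y : ∀ i, {U : Submodule K (Fin (f i) → K) // finrank K U = e i} |
    ∀ i, pluckerDet (π i) (pluckerPoint (y i)).rep ≠ 0}

theorem isOpen_chart (π : ∀ i, (Fin (f i) → K) →ₗ[K] Fin (e i) → K) : IsOpen (chart π) :=
  isOpen_iff_mem_nhds.2 fun _ hy => eventually_all.2 fun i =>
    eventually_pluckerDet_ne_zero_prodGrassmannian i (π i) (hy i)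

theorem exists_mem_chart (y : (prodGrassmannian K e f).carrier) : ∃ π, y ∈ chart π := by
  choose π hπ using fun i => exists_pluckerDet_ne_zero
    ((show ∀ i, {U : Submodule K (Fin (f i) → K) // finrank K U = e i} from y) i)
  exact ⟨π, hπ⟩

/-- Nonempty charts are isomorphic to affine spaces. -/
theorem chart_isomorphic_affineSpace (π : ∀ i, (Fin (f i) → K) →ₗ[K] Fin (e i) → K)
    (hne : (chart π).Nonempty) :
    ((prodGrassmannian K e f).subspace (chart π)).Isomorphic
      (affineSpace K (∑ i, e i * (f i - e i))) := by
  obtain ⟨y₀, hy₀⟩ := hne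
  have hs := fun i => (dualFrame_spec _ (π i) (hy₀ i)).1
  -- The frame of the base point dual to `π i` splits `π i`, and serves as the origin of the chart.
  set s : ∀ i, Fin (e i) → Fin (f i) → K := fun i => dualFrame (π i) _
  have hsurj : ∀ i, Function.Surjective (π i) := by
    intro i c
    refine ⟨∑ k, c k • s i k, ?_⟩
    rw [map_sum]
    simp only [map_smul]
    conv_rhs => rw [← Finset.univ_sum_single c]
    refine Finset.sum_congr rfl fun k _ => ?_
    rw [hs, ← Pi.single_smul, smul_eq_mul, mul_one]
  have hker : ∀ i, finrank K (LinearMap.ker (π i)) = f i - e i := by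
    intro i
    have := LinearMap.finrank_range_add_finrank_ker (π i)
    rw [LinearMap.range_eq_top.2 (hsurj i), finrank_top, finrank_fin_fun, finrank_fin_fun] at this
    omega
  -- the projection onto the kernel along the section
  let P : ∀ i, (Fin (f i) → K) →ₗ[K] LinearMap.ker (π i) := fun i =>
    LinearMap.codRestrict _ (LinearMap.id -
      (Fintype.linearCombination K (s i)) ∘ₗ π i) (by
        intro v
        rw [LinearMap.mem_ker, LinearMap.sub_apply, map_sub, LinearMap.id_apply,
          LinearMap.comp_apply, Fintype.linearCombination_apply, map_sum, sub_eq_zero]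
        conv_lhs => rw [← Finset.univ_sum_single (π i v)]
        refine Finset.sum_congr rfl fun k _ => ?_
        rw [map_smul, hs, ← Pi.single_smul, smul_eq_mul, mul_one])
  have hP : ∀ i v k, π i v = Pi.single k 1 → (P i v : Fin (f i) → K) = v - s i k := by
    intro i v k hv
    change v - Fintype.linearCombination K (s i) (π i v) = _
    rw [hv, Fintype.linearCombination_apply_single, one_smul]
  -- A subspace in the chart has a unique frame dual to `π i`, and this differs from `s i` by `e i`
  -- arbitrary vectors of the kernel, which has dimension `f i - e i`. These kernel vectors are the
  -- affine coordinates.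
  obtain ⟨Ψ⟩ : Nonempty ((Fin (∑ i, e i * (f i - e i)) → K) ≃ₗ[K]
      ∀ i, Fin (e i) → LinearMap.ker (π i)) := by
    refine FiniteDimensional.nonempty_linearEquiv_of_finrank_eq ?_
    rw [finrank_fin_fun, finrank_pi_fintype]
    refine Finset.sum_congr rfl fun i _ => ?_
    rw [finrank_pi_fintype]
    simp [hker]
  let w : (Fin (∑ i, e i * (f i - e i)) → K) → ∀ i, Fin (e i) → Fin (f i) → K :=
    fun x i k => s i k + (Ψ x i k : Fin (f i) → K)
  have hw : ∀ x i k, π i (w x i k) = Pi.single k 1 := by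
    intro x i k
    rw [map_add, hs, LinearMap.mem_ker.1 (Ψ x i k).2, add_zero]
  have hwli := fun x i => linearIndependent_of_dual (π i) (hw x i)
  let ψ : (Fin (∑ i, e i * (f i - e i)) → K) →
      ∀ i, {U : Submodule K (Fin (f i) → K) // finrank K U = e i} := fun x i =>
    ⟨Submodule.span K (Set.range (w x i)),
      (finrank_span_eq_card (hwli x i)).trans (Fintype.card_fin _)⟩
  have hψ : ∀ x i, pluckerDet (π i) (pluckerPoint (ψ x i)).rep ≠ 0 ∧
      dualFrame (π i) (pluckerPoint (ψ x i)).rep = w x i := fun x i =>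
    let h := dualFrame_eq (ψ x i) (π i) (hw x i) rfl
    ⟨h.1, h.2.1⟩
  let φ : (∀ i, {U : Submodule K (Fin (f i) → K) // finrank K U = e i}) →
      Fin (∑ i, e i * (f i - e i)) → K := fun y =>
    Ψ.symm fun i k => P i (dualFrame (π i) (pluckerPoint (y i)).rep k)
  have hφψ : ∀ x, φ (ψ x) = x := by
    intro x
    refine Ψ.symm_apply_eq.2 ?_
    ext i k : 3
    rw [(hψ x i).2, hP i _ k (hw x i k)]
    exact add_sub_cancel_left _ _
  have hψφ : ∀ y, y ∈ chart π → ψ (φ y) = y := by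
    intro y hy
    funext i
    apply Subtype.ext
    obtain ⟨h1, h2⟩ := dualFrame_spec _ (π i) (hy i)
    rw [← h2]
    change Submodule.span K (Set.range (w (φ y) i)) = _
    congr 2
    ext1 k
    change s i k + (Ψ (Ψ.symm _) i k : Fin (f i) → K) = _
    rw [LinearEquiv.apply_symm_apply, hP i _ k (h1 k), add_sub_cancel]
  refine ⟨⟨fun y => φ y.1, fun x => ⟨ψ x, fun i => (hψ x i).1⟩, fun y => Subtype.ext (hψφ y.1 y.2),
    hφψ⟩, ?_, ?_⟩
  · refine isMorphism_affineSpace isGeometric_prodGrassmannian.induced fun y => ?_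
    have hG := isGeometric_prodGrassmannian (K := K) (e := e) (f := f)
    refine RegularVec.comp (X := (prodGrassmannian K e f).subspace (chart π))
      (Y := prodGrassmannian K e f) isMorphism_induced (F := φ) ?_
    refine RegularVec.map (RegularVec.pi hG fun i => RegularVec.pi hG fun k => ?_)
      Ψ.symm.toLinearMap
    exact (regularVec_dualFrame_prodGrassmannian i (π i) (y.2 i) k).map (P i)
  · have hA := isGeometric_affineSpace (K := K) (∑ i, e i * (f i - e i))
    refine isMorphism_induced_of_comp hA (isMorphism_prodGrassmannian (φ := ψ) hA fun z i =>
      ⟨fun k x => w x i k, fun k => ?_, Eventually.of_forall fun x => ⟨hwli x i, rfl⟩⟩)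
    exact (hA.regularVec_const (s i k) z).add hA ((regularVec_affineSpace _ z).map
      ((LinearMap.ker (π i)).subtype ∘ₗ
        (LinearMap.proj k : (Fin (e i) → LinearMap.ker (π i)) →ₗ[K] _) ∘ₗ
        (LinearMap.proj i : (∀ i, Fin (e i) → LinearMap.ker (π i)) →ₗ[K] _) ∘ₗ Ψ.toLinearMap))

theorem nonempty_prodGrassmannian (hef : ∀ i, e i ≤ f i) :
    Nonempty (prodGrassmannian K e f).carrier := by
  have : ∀ i, ∃ U : Submodule K (Fin (f i) → K), finrank K U = e i := fun i => by
    have h := (Pi.basisFun K (Fin (f i))).linearIndependent.comp _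
      (Fin.castLE_injective (hef i))
    exact ⟨_, (finrank_span_eq_card h).trans (Fintype.card_fin _)⟩
  choose U hU using this
  exact ⟨fun i => ⟨U i, hU i⟩⟩

theorem isRational_prodGrassmannian (hef : ∀ i, e i ≤ f i) :
    IsRational (prodGrassmannian K e f) := by
  obtain ⟨y⟩ := nonempty_prodGrassmannian (K := K) hef
  obtain ⟨π, hy⟩ := exists_mem_chart y
  exact ⟨_, chart π, Set.univ, isOpen_chart π, ⟨y, hy⟩, isOpen_univ, ⟨(0 : Fin _ → K), trivial⟩,
    (chart_isomorphic_affineSpace π ⟨y, hy⟩).trans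
      (isomorphic_subspace_univ (isGeometric_affineSpace _))⟩

/-- The charts form an open cover, and every nonempty one is an affine space of the same dimension.
-/
theorem topologicalKrullDim_prodGrassmannian [IsAlgClosed K] (hef : ∀ i, e i ≤ f i) :
    topologicalKrullDim (prodGrassmannian K e f).carrier = (∑ i, e i * (f i - e i) : ℕ) := by
  have hchart : ∀ π : ∀ i, (Fin (f i) → K) →ₗ[K] Fin (e i) → K, (chart π).Nonempty →
      topologicalKrullDim (chart π) = (∑ i, e i * (f i - e i) : ℕ) := by
    intro π hπ
    obtain ⟨h⟩ := (chart_isomorphic_affineSpace π hπ).nonempty_homeomorph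
    rw [← topologicalKrullDim_affineSpace (K := K)]
    exact IsHomeomorph.topologicalKrullDim_eq _ h.isHomeomorph
  apply le_antisymm
  · refine topologicalKrullDim_le_of_forall_exists_isOpen fun y => ?_
    obtain ⟨π, hy⟩ := exists_mem_chart y
    exact ⟨chart π, isOpen_chart π, hy, (hchart π ⟨y, hy⟩).le⟩
  · obtain ⟨y⟩ := nonempty_prodGrassmannian (K := K) hef
    obtain ⟨π, hy⟩ := exists_mem_chart y
    rw [← hchart π ⟨y, hy⟩]
    exact topologicalKrullDim_subspace_le _ _

/-- Tuples of linearly independent families form an open subset of an affine space, hence an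
irreducible one, and taking spans maps it continuously onto the product. -/
theorem irreducibleSpace_prodGrassmannian [Infinite K] (hef : ∀ i, e i ≤ f i) :
    IrreducibleSpace (prodGrassmannian K e f).carrier := by
  obtain ⟨y₀⟩ := nonempty_prodGrassmannian (K := K) hef
  obtain ⟨Ψ⟩ : Nonempty ((Fin (∑ i, e i * f i) → K) ≃ₗ[K] ∀ i, Fin (e i) → Fin (f i) → K) := by
    refine FiniteDimensional.nonempty_linearEquiv_of_finrank_eq ?_
    rw [finrank_fin_fun, finrank_pi_fintype]
    refine Finset.sum_congr rfl fun i _ => ?_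
    rw [finrank_pi_fintype]
    simp
  let A := affineSpace K (∑ i, e i * f i)
  have hA : A.IsGeometric := isGeometric_affineSpace _
  let S : Set A.carrier := {x : Fin (∑ i, e i * f i) → K | ∀ i, LinearIndependent K (Ψ x i)}
  have hreg : ∀ (x : A.carrier) i k, A.RegularVec
      (fun x : Fin (∑ i, e i * f i) → K => Ψ x i k) x := fun x i k =>
    (regularVec_affineSpace _ x).map
      ((LinearMap.proj k : (Fin (e i) → Fin (f i) → K) →ₗ[K] _) ∘ₗ
        (LinearMap.proj i : (∀ i, Fin (e i) → Fin (f i) → K) →ₗ[K] _) ∘ₗ Ψ.toLinearMap)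
  have hS : IsOpen S := isOpen_iff_mem_nhds.2 fun x hx => eventually_all.2 fun i =>
    eventually_linearIndependent hA (hreg x i) (hx i)
  let ψ : S → ∀ i, {U : Submodule K (Fin (f i) → K) // finrank K U = e i} := fun x i =>
    ⟨Submodule.span K (Set.range (Ψ x.1 i)),
      (finrank_span_eq_card (x.2 i)).trans (Fintype.card_fin _)⟩
  have hψ : IsMorphism (X := A.subspace S) (Y := prodGrassmannian K e f) ψ := by
    refine isMorphism_prodGrassmannian hA.induced fun z i => ⟨fun k x => Ψ x.1 i k, fun k => ?_,
      Eventually.of_forall fun x => ⟨x.2 i, rfl⟩⟩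
    exact RegularVec.comp (X := A.subspace S) (Y := A) isMorphism_induced
      (F := fun x => Ψ x i k) (hreg z.1 i k)
  have hsurj : Function.Surjective ψ := by
    intro y
    choose v hv hvU using fun i => exists_frame (y i).2
    refine ⟨⟨Ψ.symm v, fun i => by rw [LinearEquiv.apply_symm_apply]; exact hv i⟩, ?_⟩
    funext i
    apply Subtype.ext
    change Submodule.span K (Set.range (Ψ (Ψ.symm v) i)) = _
    rw [LinearEquiv.apply_symm_apply, hvU]
  let ψ' : (A.subspace S).carrier → (prodGrassmannian K e f).carrier := ψ
  have hirr : IsPreirreducible (ψ' '' Set.univ) := by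
    refine IsPreirreducible.image ?_ _ hψ.1.continuousOn
    have : IrreducibleSpace A.carrier := irreducibleSpace_affineSpace
    have : IsPreirreducible S :=
      (PreirreducibleSpace.isPreirreducible_univ (X := A.carrier)).open_subset hS
        (Set.subset_univ _)
    exact (Subtype.preirreducibleSpace this).isPreirreducible_univ
  rw [Set.image_univ_of_surjective (f := ψ') hsurj] at hirr
  exact { isPreirreducible_univ := hirr, toNonempty := ⟨y₀⟩ }

end ProdGrassmannian

end SpaceWithFunctions

/-! ### Irreducible representations, characters and multiplicities. -/

section Representations

open Module Representation

variable {K E V W : Type*} [Field K] [Group E] [AddCommGroup V] [Module K V]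
  [AddCommGroup W] [Module K W]

/-! ### Irreducible subrepresentations -/

theorem Representation.IsIrreducible.of_equiv {σ : Representation K E V}
    {τ : Representation K E W} (φ : σ.Equiv τ) (hσ : σ.IsIrreducible) : τ.IsIrreducible where
  exists_pair_ne := by
    obtain ⟨v, hv⟩ : ∃ v : V, v ≠ 0 := by
      by_contra! h
      exact bot_ne_top (α := Subrepresentation σ)
        (SetLike.ext fun v => ⟨fun _ => True.intro, fun _ => h v⟩)
    refine ⟨⊥, ⊤, fun h => hv (φ.toLinearEquiv.map_eq_zero_iff.1 ?_)⟩
    have : φ.toLinearEquiv v ∈ (⊥ : Subrepresentation τ) := h ▸ True.intro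
    exact this
  eq_bot_or_eq_top A := by
    let B : Subrepresentation σ :=
      ⟨A.toSubmodule.comap φ.toIntertwiningMap.toLinearMap, fun g v hv => by
        change φ.toIntertwiningMap (σ g v) ∈ A.toSubmodule
        rw [φ.toIntertwiningMap.isIntertwining]
        exact A.apply_mem_toSubmodule g hv⟩
    have hB : ∀ w, w ∈ A ↔ φ.toLinearEquiv.symm w ∈ B := fun w => by
      change _ ↔ φ.toLinearEquiv (φ.toLinearEquiv.symm w) ∈ A
      rw [LinearEquiv.apply_symm_apply]
    rcases hσ.eq_bot_or_eq_top B with h | h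
    · refine Or.inl (SetLike.ext fun w => ?_)
      rw [hB, h]
      exact φ.toLinearEquiv.symm.map_eq_zero_iff
    · refine Or.inr (SetLike.ext fun w => ?_)
      rw [hB, h]
      exact ⟨fun _ => True.intro, fun _ => True.intro⟩

theorem Subrepresentation.isIrreducible_of_isAtom {ρ : Representation K E V}
    {S : Subrepresentation ρ} (hS : IsAtom S) : S.toRepresentation.IsIrreducible where
  exists_pair_ne := by
    refine ⟨⊥, ⊤, fun h => hS.1 (SetLike.ext fun v => ⟨fun hv => ?_, fun hv => ?_⟩)⟩
    · have : (⟨v, hv⟩ : S.toSubmodule) ∈ (⊥ : Subrepresentation S.toRepresentation) := h ▸ trivial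
      exact congrArg Subtype.val (show (⟨v, hv⟩ : S.toSubmodule) = 0 from this)
    · rw [show v = 0 from hv]
      exact S.toSubmodule.zero_mem
  eq_bot_or_eq_top A := by
    let B : Subrepresentation ρ := ⟨A.toSubmodule.map S.toSubmodule.subtype, by
      rintro g _ ⟨v, hv, rfl⟩
      exact ⟨S.toRepresentation g v, A.apply_mem_toSubmodule g hv, rfl⟩⟩
    have hB : ∀ v : S.toSubmodule, v ∈ A ↔ (v : V) ∈ B := fun v =>
      ⟨fun hv => ⟨v, hv, rfl⟩, by rintro ⟨w, hw, h⟩; exact Subtype.ext h ▸ hw⟩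
    have hBS : B ≤ S := by
      rintro _ ⟨v, -, rfl⟩
      exact v.2
    rcases hS.le_iff.1 hBS with h | h
    · refine Or.inl (SetLike.ext fun v => ?_)
      rw [hB, h]
      exact ⟨fun h => Subtype.ext h, fun h => congrArg Subtype.val h⟩
    · refine Or.inr (SetLike.ext fun v => ?_)
      rw [hB, h]
      exact ⟨fun _ => trivial, fun _ => v.2⟩

theorem Subrepresentation.exists_isAtom_le [FiniteDimensional K V] {ρ : Representation K E V}
    {A : Subrepresentation ρ} (hA : A ≠ ⊥) : ∃ S : Subrepresentation ρ, IsAtom S ∧ S ≤ A := by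
  have hmono : StrictMono (toSubmodule : Subrepresentation ρ → Submodule K V) :=
    Monotone.strictMono_of_injective (fun _ _ h => h) toSubmodule_injective
  have : WellFoundedLT (Subrepresentation ρ) := hmono.wellFoundedLT
  exact ((isAtomic_of_orderBot_wellFounded_lt wellFounded_lt).eq_bot_or_exists_atom_le A).resolve_left
    hA

/-- The representation on `Kⁿ` obtained by choosing a basis. -/
noncomputable def Representation.onPi [FiniteDimensional K V] (σ : Representation K E V) :
    Representation K E (Fin (finrank K V) → K) :=
  ((finBasis K V).equivFun.conjRingEquiv : End K V →* End K (Fin (finrank K V) → K)).comp σ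

/-- The representation on `Kⁿ` obtained by choosing a basis is isomorphic to the given one. -/
noncomputable def Representation.equivOnPi [FiniteDimensional K V] (σ : Representation K E V) :
    σ.Equiv σ.onPi :=
  Equiv.mk (finBasis K V).equivFun fun g => by
    ext v : 1
    change (finBasis K V).equivFun (σ g v) = (finBasis K V).equivFun
      (σ g ((finBasis K V).equivFun.symm ((finBasis K V).equivFun v)))
    rw [LinearEquiv.symm_apply_apply]

theorem isKCharacter_character [FiniteDimensional K V] (σ : Representation K E V) :
    IsKCharacter K E σ.character :=
  ⟨_, σ.onPi, (char_iso σ.equivOnPi).symm⟩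

theorem character_eq_add_of_isCompl [FiniteDimensional K V] {ρ : Representation K E V}
    {S C : Subrepresentation ρ} (h : IsCompl S C) :
    ρ.character = S.toRepresentation.character + C.toRepresentation.character := by
  have h' : IsCompl S.toSubmodule C.toSubmodule := by
    rw [isCompl_iff, disjoint_iff, codisjoint_iff] at h ⊢
    exact ⟨(Subrepresentation.toSubmodule_inf _ _).symm.trans
      (congrArg Subrepresentation.toSubmodule h.1),
      (Subrepresentation.toSubmodule_sup _ _).symm.trans
      (congrArg Subrepresentation.toSubmodule h.2)⟩
  ext g
  let e := Submodule.prodEquivOfIsCompl _ _ h'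
  have he : ρ g = e.conj (LinearMap.prodMap (S.toRepresentation g) (C.toRepresentation g)) := by
    ext v
    obtain ⟨w, rfl⟩ := e.surjective v
    rw [LinearEquiv.conj_apply_apply, LinearEquiv.symm_apply_apply]
    change ρ g (w.1 + w.2) = _
    rw [map_add]
    rfl
  change LinearMap.trace K V (ρ g) = _
  rw [he, LinearMap.trace_conj', LinearMap.trace_prodMap']
  rfl

/-! ### Irreducible characters -/

/-- The degree of an irreducible character. -/
noncomputable def irrDim (μ : IrrK K E) : ℕ := μ.2.choose

/-- An irreducible representation affording an irreducible character. -/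
noncomputable def irrRep (μ : IrrK K E) : Representation K E (Fin (irrDim μ) → K) :=
  μ.2.choose_spec.choose

instance isIrreducible_irrRep (μ : IrrK K E) : (irrRep μ).IsIrreducible :=
  μ.2.choose_spec.choose_spec.1

theorem character_irrRep (μ : IrrK K E) : (irrRep μ).character = μ :=
  μ.2.choose_spec.choose_spec.2

theorem irrDim_pos (μ : IrrK K E) : 0 < irrDim μ := by
  by_contra h
  have h0 : irrDim μ = 0 := by omega
  have : Subsingleton (Fin (irrDim μ) → K) := by
    rw [h0]
    infer_instance
  exact bot_ne_top (α := Subrepresentation (irrRep μ))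
    (SetLike.ext fun v => ⟨fun _ => trivial, fun _ => Subsingleton.elim v 0⟩)

theorem charSum_apply (e : IrrK K E →₀ ℕ) (g : E) :
    charSum e g = e.sum fun μ m => (m : K) * (μ : E → K) g := by
  simp [charSum, Finsupp.sum]

theorem charSum_add (e e' : IrrK K E →₀ ℕ) : charSum (e + e') = charSum e + charSum e' :=
  Finsupp.sum_add_index' (fun _ => zero_smul _ _) fun _ _ _ => add_smul _ _ _

theorem charSum_one (e : IrrK K E →₀ ℕ) :
    charSum e 1 = ((∑ μ ∈ e.support, e μ * irrDim μ : ℕ) : K) := by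
  rw [charSum_apply, Finsupp.sum, Nat.cast_sum]
  refine Finset.sum_congr rfl fun μ _ => ?_
  rw [← character_irrRep μ, char_one, finrank_fin_fun, Nat.cast_mul]

/-- The multiplicity of `μ` in a representation. -/
noncomputable def repMult (ρ : Representation K E V) (μ : IrrK K E) : ℕ :=
  finrank K (IntertwiningMap (irrRep μ) ρ)

open Classical in
theorem repMult_irrRep [IsAlgClosed K] (μ ν : IrrK K E) : repMult (irrRep μ) ν = if μ = ν then 1 else 0 := by
  split_ifs with h
  · subst h
    exact IsIrreducible.finrank_intertwiningMap_self (irrRep μ)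
  · have : IsEmpty (Equiv (irrRep ν) (irrRep μ)) := ⟨fun φ => h <| Subtype.ext <| by
      rw [← character_irrRep μ, ← character_irrRep ν, char_iso φ]⟩
    exact finrank_eq_zero_of_subsingleton _ _

section Finite

variable [Finite E] [CharZero K]

theorem repMult_eq [Fintype E] [FiniteDimensional K V] (ρ : Representation K E V)
    (μ : IrrK K E) :
    (repMult ρ μ : K) = (Nat.card E : K)⁻¹ * ∑ g : E, ρ.character g * (μ : E → K) g⁻¹ := by
  have : Invertible (Nat.card E : K) := invertibleOfNonzero (Nat.cast_ne_zero.2 Nat.card_pos.ne')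
  rw [← character_irrRep μ, card_inv_mul_sum_char_mul_char_eq_finrank, repMult]

variable [IsAlgClosed K]

/-- An irreducible representation is isomorphic to the chosen one with the same character. -/
theorem exists_equiv_irrRep [FiniteDimensional K V] (σ : Representation K E V)
    (hσ : σ.IsIrreducible) : ∃ μ : IrrK K E, Nonempty ((irrRep μ).Equiv σ) := by
  have := Fintype.ofFinite E
  have : Invertible (Nat.card E : K) := invertibleOfNonzero (Nat.cast_ne_zero.2 Nat.card_pos.ne')
  have hirr := hσ.of_equiv σ.equivOnPi
  refine ⟨⟨σ.onPi.character, _, _, hirr, rfl⟩, ?_⟩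
  set μ : IrrK K E := ⟨σ.onPi.character, _, _, hirr, rfl⟩
  -- The two irreducible representations share a character, so their scalar product equals that of
  -- `σ.onPi` with itself, namely 1; by orthogonality they are isomorphic.
  have h1 := char_orthonormal σ.onPi (irrRep μ)
  have h2 := char_orthonormal σ.onPi σ.onPi
  rw [if_pos ⟨Representation.Equiv.refl _⟩] at h2
  rw [character_irrRep, h2] at h1
  by_cases h : Nonempty ((irrRep μ).Equiv σ.onPi)
  · exact h.map fun φ => φ.trans σ.equivOnPi.symm
  · rw [if_neg h] at h1
    exact absurd h1 one_ne_zero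

theorem charSum_inner [Fintype E] (e : IrrK K E →₀ ℕ) (ν : IrrK K E) :
    (e ν : K) = (Nat.card E : K)⁻¹ * ∑ g : E, charSum e g * (ν : E → K) g⁻¹ := by
  classical
  simp only [charSum_apply, Finsupp.sum, Finset.sum_mul]
  rw [Finset.sum_comm, Finset.mul_sum]
  have : ∀ μ ∈ e.support, (Nat.card E : K)⁻¹ * ∑ g : E, (e μ : K) * (μ : E → K) g * (ν : E → K) g⁻¹
      = if μ = ν then (e μ : K) else 0 := by
    intro μ _
    have h := repMult_eq (irrRep μ) ν
    rw [repMult_irrRep, character_irrRep] at h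
    simp only [mul_assoc]
    rw [← Finset.mul_sum, mul_left_comm, ← h]
    split_ifs <;> simp
  rw [Finset.sum_congr rfl this, Finset.sum_ite_eq']
  split_ifs with h
  · rfl
  · rw [Finsupp.notMem_support_iff.1 h, Nat.cast_zero]

/-- Orthonormality recovers each coefficient as an element of `K`, and characteristic zero makes it
determine the natural number. Hence the choice in `charMult` is forced. -/
theorem charSum_injective : Function.Injective (charSum : (IrrK K E →₀ ℕ) → E → K) := by
  have := Fintype.ofFinite E
  intro e e' h
  ext ν
  have h1 := charSum_inner e ν
  rw [h, ← charSum_inner e' ν] at h1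
  exact_mod_cast h1

theorem charMult_charSum (e : IrrK K E →₀ ℕ) : charMult (charSum e) = e := by
  have h : ∃ e' : IrrK K E →₀ ℕ, charSum e' = charSum e := ⟨e, rfl⟩
  rw [charMult, dif_pos h]
  exact charSum_injective h.choose_spec

/-- Induction on the dimension: by Maschke's theorem a simple submodule splits off, and the
character is additive. -/
theorem exists_charSum_eq_character {V : Type*} [AddCommGroup V] [Module K V]
    [FiniteDimensional K V] (ρ : Representation K E V) :
    ∃ e : IrrK K E →₀ ℕ, charSum e = ρ.character := by
  induction hn : finrank K V using Nat.strong_induction_on generalizing V with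
  | _ n ih =>
    have : NeZero (Nat.card E : K) := ⟨Nat.cast_ne_zero.2 Nat.card_pos.ne'⟩
    by_cases hbot : (⊤ : Subrepresentation ρ) = ⊥
    · refine ⟨0, ?_⟩
      have : Subsingleton V := ⟨fun v w => by
        have h : ∀ v : V, v = 0 := fun v => by
          have : v ∈ (⊥ : Subrepresentation ρ) := hbot ▸ trivial
          exact this
        rw [h v, h w]⟩
      ext g
      rw [Representation.character, Subsingleton.elim (ρ g) 0, map_zero]
      simp [charSum]
    · obtain ⟨S, hS, -⟩ := Subrepresentation.exists_isAtom_le hbot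
      obtain ⟨C, hC⟩ := exists_isCompl S
      obtain ⟨μ, ⟨φ⟩⟩ := exists_equiv_irrRep _ (Subrepresentation.isIrreducible_of_isAtom hS)
      have hlt : finrank K C.toSubmodule < finrank K V := by
        refine Submodule.finrank_lt fun h => hS.1 ?_
        have : C = ⊤ := Subrepresentation.toSubmodule_injective h
        rw [this] at hC
        exact inf_top_eq S ▸ hC.inf_eq_bot
      obtain ⟨e, he⟩ := ih _ (hn ▸ hlt) C.toRepresentation rfl
      refine ⟨Finsupp.single μ 1 + e, ?_⟩
      rw [charSum_add, he, character_eq_add_of_isCompl hC, ← char_iso φ, character_irrRep]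
      congr 1
      exact (Finsupp.sum_single_index (h := fun (μ : IrrK K E) m => m • (μ : E → K))
        (zero_smul ℕ _)).trans (one_smul ℕ _)

theorem charSum_charMult [FiniteDimensional K V] (ρ : Representation K E V) :
    charSum (charMult ρ.character) = ρ.character := by
  obtain ⟨e, he⟩ := exists_charSum_eq_character ρ
  rw [← he, charMult_charSum]

theorem charMult_character [FiniteDimensional K V] (ρ : Representation K E V) (μ : IrrK K E) :
    charMult ρ.character μ = repMult ρ μ := by
  have := Fintype.ofFinite E
  have h := charSum_inner (charMult ρ.character) μ
  rw [charSum_charMult, ← repMult_eq] at h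
  exact_mod_cast h

/-- Evaluation of the character at 1. It supplies the dimension count that makes the sum of isotypic
pieces direct. -/
theorem sum_charMult_mul_irrDim [FiniteDimensional K V] (ρ : Representation K E V) :
    ∑ μ ∈ (charMult ρ.character).support, charMult ρ.character μ * irrDim μ = finrank K V := by
  have h := charSum_one (charMult ρ.character)
  rw [charSum_charMult, char_one] at h
  exact_mod_cast h.symm

end Finite

end Representations

/-- The images of the standard basis vectors span `V` and their number is the dimension, so they
form a basis; the projections are its coordinate maps, grouped by block. -/
theorem exists_dual_projections {K V M : Type*} [Field K] [AddCommGroup V] [Module K V]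
    [FiniteDimensional K V] {n f : M → ℕ} (incl : ∀ μ, Fin (n μ) → (Fin (f μ) → K) →ₗ[K] V)
    (s : Finset M) (hs : ∀ μ, f μ ≠ 0 → μ ∈ s)
    (hspan : ⊤ ≤ ⨆ μ, ⨆ k, LinearMap.range (incl μ k))
    (hcard : ∑ μ ∈ s, f μ * n μ = Module.finrank K V) :
    ∃ π : ∀ μ, Fin (n μ) → V →ₗ[K] (Fin (f μ) → K),
      (∀ μ k a, π μ k (incl μ k a) = a) ∧
      ∀ μ k ν l a, (⟨μ, k⟩ : Σ μ, Fin (n μ)) ≠ ⟨ν, l⟩ → π μ k (incl ν l a) = 0 := by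
  classical
  let I := Σ μ : s, Fin (n μ) × Fin (f μ)
  let B : I → V := fun i => incl i.1 i.2.1 (Pi.single i.2.2 1)
  have hexp : ∀ μ k a, incl μ k a = ∑ j, a j • incl μ k (Pi.single j 1) := by
    intro μ k a
    conv_lhs => rw [← Finset.univ_sum_single a, map_sum]
    refine Finset.sum_congr rfl fun j _ => ?_
    rw [← map_smul, ← Pi.single_smul, smul_eq_mul, mul_one]
  -- An index `j` is itself the evidence that `f μ ≠ 0`, so blocks outside the finite set `s` are
  -- empty and need no separate treatment.
  have hsupp : ∀ μ, Fin (f μ) → μ ∈ s := fun μ j => hs μ j.pos.ne'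
  have hspanB : ⊤ ≤ Submodule.span K (Set.range B) := by
    refine hspan.trans (iSup_le fun μ => iSup_le fun k => ?_)
    rintro _ ⟨a, rfl⟩
    rw [hexp]
    exact Submodule.sum_mem _ fun j _ => Submodule.smul_mem _ _
      (Submodule.subset_span ⟨⟨⟨μ, hsupp μ j⟩, k, j⟩, rfl⟩)
  have hcardB : Fintype.card I = Module.finrank K V := by
    rw [← hcard, Fintype.card_sigma, ← Finset.sum_coe_sort s fun μ => f μ * n μ]
    refine Finset.sum_congr rfl fun μ _ => ?_
    rw [Fintype.card_prod, Fintype.card_fin, Fintype.card_fin, mul_comm]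
  let b : Module.Basis I K V := basisOfTopLeSpanOfCardEqFinrank B hspanB hcardB
  let π : ∀ μ, Fin (n μ) → V →ₗ[K] (Fin (f μ) → K) := fun μ k =>
    LinearMap.pi fun j => b.coord ⟨⟨μ, hsupp μ j⟩, k, j⟩
  have hπ : ∀ μ k j ν l i, π μ k (incl ν l (Pi.single i 1)) j =
      if (⟨⟨ν, hsupp ν i⟩, l, i⟩ : I) = ⟨⟨μ, hsupp μ j⟩, k, j⟩ then 1 else 0 := by
    intro μ k j ν l i
    have : incl ν l (Pi.single i 1) = b ⟨⟨ν, hsupp ν i⟩, l, i⟩ := by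
      rw [coe_basisOfTopLeSpanOfCardEqFinrank]
    rw [this, LinearMap.pi_apply, Module.Basis.coord_apply, Module.Basis.repr_self,
      Finsupp.single_apply]
  refine ⟨π, fun μ k a => ?_, fun μ k ν l a hne => ?_⟩
  · ext j
    rw [hexp, map_sum, Finset.sum_apply, Finset.sum_eq_single j]
    · rw [map_smul, Pi.smul_apply, hπ, if_pos rfl, smul_eq_mul, mul_one]
    · intro i _ hij
      rw [map_smul, Pi.smul_apply, hπ, if_neg, smul_zero]
      intro h
      simp only [Sigma.mk.injEq, heq_eq_eq, Prod.mk.injEq, true_and] at h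
      exact hij h
    · simp
  · ext j
    rw [hexp, map_sum, Finset.sum_apply]
    refine Finset.sum_eq_zero fun i _ => ?_
    rw [map_smul, Pi.smul_apply, hπ, if_neg, smul_zero]
    intro h
    apply hne
    have h1 : ν = μ := congrArg (fun i : I => (i.1 : M)) h
    subst h1
    simp only [Sigma.mk.injEq, heq_eq_eq, Prod.mk.injEq, true_and] at h
    rw [h.1]

/-! ### Submodules of `M` as families of subspaces of multiplicity spaces. -/

section Structure

open Module Representation

variable {K E V : Type*} [Field K] [IsAlgClosed K] [CharZero K] [Group E] [Finite E]
  [AddCommGroup V] [Module K V] [FiniteDimensional K V] (ρ : Representation K E V)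

/-- A basis of the space of homomorphisms from an irreducible module to `M`. -/
noncomputable def homBasis (μ : IrrK K E) :
    Basis (Fin (charMult ρ.character μ)) K (IntertwiningMap (irrRep μ) ρ) :=
  finBasisOfFinrankEq _ _ (charMult_character ρ μ).symm

/-- The homomorphism with given coordinates. -/
noncomputable def coordHom (μ : IrrK K E) :
    (Fin (charMult ρ.character μ) → K) ≃ₗ[K] IntertwiningMap (irrRep μ) ρ :=
  (homBasis ρ μ).equivFun.symm

/-- The map `a ↦ a ⊗ s_k` from the multiplicity space of `μ` to `M`. -/
noncomputable def isoIncl (μ : IrrK K E) (k : Fin (irrDim μ)) :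
    (Fin (charMult ρ.character μ) → K) →ₗ[K] V :=
  LinearMap.applyₗ (Pi.single k 1) ∘ₗ IntertwiningMap.toLinearMapl _ _ ∘ₗ
    (coordHom ρ μ).toLinearMap

theorem isoIncl_apply (μ : IrrK K E) (k : Fin (irrDim μ)) (a : Fin (charMult ρ.character μ) → K) :
    isoIncl ρ μ k a = coordHom ρ μ a (Pi.single k 1) := rfl

theorem coordHom_apply (μ : IrrK K E) (a : Fin (charMult ρ.character μ) → K)
    (s : Fin (irrDim μ) → K) : coordHom ρ μ a s = ∑ k, s k • isoIncl ρ μ k a := by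
  change (coordHom ρ μ a).toLinearMap s = _
  conv_lhs => rw [← Finset.univ_sum_single s, map_sum]
  refine Finset.sum_congr rfl fun k _ => ?_
  have : (Pi.single k (s k) : Fin (irrDim μ) → K) = s k • Pi.single k 1 := by
    rw [← Pi.single_smul, smul_eq_mul, mul_one]
  rw [this, map_smul]
  rfl

variable {ρ}

/-- The multiplicity space `Hom_E(S_μ, U)` of a submodule `U`. -/
noncomputable def homSub (U : Subrepresentation ρ) (μ : IrrK K E) :
    Submodule K (Fin (charMult ρ.character μ) → K) where
  carrier := {a | ∀ s, coordHom ρ μ a s ∈ U.toSubmodule}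
  zero_mem' s := by
    rw [map_zero]
    exact U.toSubmodule.zero_mem
  add_mem' ha hb s := by
    rw [map_add]
    exact U.toSubmodule.add_mem (ha s) (hb s)
  smul_mem' c a ha s := by
    rw [map_smul]
    exact U.toSubmodule.smul_mem c (ha s)

theorem isoIncl_mem {U : Subrepresentation ρ} {μ : IrrK K E}
    {a : Fin (charMult ρ.character μ) → K} (ha : a ∈ homSub U μ) (k : Fin (irrDim μ)) :
    isoIncl ρ μ k a ∈ U.toSubmodule :=
  ha _

/-- Homomorphisms to `M` with image in `U` are the homomorphisms to `U`, and their dimension is the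
multiplicity of `μ` in `U`. -/
theorem finrank_homSub (U : Subrepresentation ρ) (μ : IrrK K E) :
    finrank K (homSub U μ) = charMult U.toRepresentation.character μ := by
  let incl : IntertwiningMap U.toRepresentation ρ := ⟨U.toSubmodule.subtype, fun g => rfl⟩
  let L : IntertwiningMap (irrRep μ) U.toRepresentation →ₗ[K]
      (Fin (charMult ρ.character μ) → K) :=
    (coordHom ρ μ).symm.toLinearMap ∘ₗ IntertwiningMap.llcomp _ _ _ incl
  have hL : ∀ φ s, coordHom ρ μ (L φ) s = φ s := fun φ s => by
    change coordHom ρ μ ((coordHom ρ μ).symm _) s = _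
    rw [LinearEquiv.apply_symm_apply]
    rfl
  have hinj : Function.Injective L := by
    intro φ ψ h
    refine IntertwiningMap.ext (LinearMap.ext fun s => Subtype.ext ?_)
    exact (hL φ s).symm.trans ((congrArg (fun a => coordHom ρ μ a s) h).trans (hL ψ s))
  have hrange : LinearMap.range L = homSub U μ := by
    ext a
    constructor
    · rintro ⟨φ, rfl⟩ s
      rw [hL]
      exact (φ s).2
    · intro ha
      refine ⟨⟨(coordHom ρ μ a).toLinearMap.codRestrict U.toSubmodule ha, fun g => ?_⟩, ?_⟩
      · refine LinearMap.ext fun s => Subtype.ext ?_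
        exact IntertwiningMap.isIntertwining _ _ (coordHom ρ μ a) g s
      · apply (coordHom ρ μ).injective
        exact IntertwiningMap.ext (LinearMap.ext (hL _))
  rw [← hrange, LinearMap.finrank_range_of_inj hinj, charMult_character, repMult]

/-- The submodule generated by subspaces of the multiplicity spaces. -/
noncomputable def ofMultiplicitySpaces
    (A : ∀ μ : IrrK K E, Submodule K (Fin (charMult ρ.character μ) → K)) :
    Subrepresentation ρ where
  toSubmodule := ⨆ μ, ⨆ k, (A μ).map (isoIncl ρ μ k)
  apply_mem_toSubmodule g := by
    intro v hv
    have : (⨆ μ, ⨆ k, (A μ).map (isoIncl ρ μ k)) ≤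
        (⨆ μ, ⨆ k, (A μ).map (isoIncl ρ μ k)).comap (ρ g) := by
      refine iSup_le fun μ => iSup_le fun k => ?_
      rintro _ ⟨a, ha, rfl⟩
      -- The group acts on the `S_μ` factor only: translating by `g` changes the vector of `S_μ` but
      -- keeps the same `a`.
      rw [Submodule.mem_comap, isoIncl_apply,
        ← IntertwiningMap.isIntertwining _ _ (coordHom ρ μ a) g, coordHom_apply]
      exact Submodule.sum_mem _ fun l _ => Submodule.smul_mem _ _
        (Submodule.mem_iSup_of_mem μ (Submodule.mem_iSup_of_mem l ⟨a, ha, rfl⟩))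
    exact this hv

/-- Every submodule is generated by its multiplicity spaces. -/
theorem ofMultiplicitySpaces_homSub (U : Subrepresentation ρ) :
    ofMultiplicitySpaces (homSub U) = U := by
  set T := ofMultiplicitySpaces (homSub U) with hT
  have hTU : T ≤ U := by
    change (⨆ μ, ⨆ k, (homSub U μ).map (isoIncl ρ μ k)) ≤ U.toSubmodule
    refine iSup_le fun μ => iSup_le fun k => ?_
    rintro _ ⟨a, ha, rfl⟩
    exact isoIncl_mem ha k
  refine hTU.antisymm ?_
  have : NeZero (Nat.card E : K) := ⟨Nat.cast_ne_zero.2 Nat.card_pos.ne'⟩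
  obtain ⟨C, hC⟩ := exists_isCompl T
  -- A simple submodule of `C ⊓ U` is the image of a homomorphism from some `S_μ` into `U`; this
  -- belongs to `homSub U μ`, so its image already lies in `T`, which meets the complement `C`
  -- trivially.
  have hCU : C ⊓ U = ⊥ := by
    by_contra hne
    obtain ⟨S, hS, hSle⟩ := Subrepresentation.exists_isAtom_le hne
    obtain ⟨μ, ⟨φ⟩⟩ := exists_equiv_irrRep _ (Subrepresentation.isIrreducible_of_isAtom hS)
    let incl : IntertwiningMap S.toRepresentation ρ := ⟨S.toSubmodule.subtype, fun g => rfl⟩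
    let ψ : IntertwiningMap (irrRep μ) ρ := incl.comp φ.toIntertwiningMap
    have hψ : ∀ s, coordHom ρ μ ((coordHom ρ μ).symm ψ) s = φ.toLinearEquiv s := fun s => by
      rw [LinearEquiv.apply_symm_apply]
      rfl
    have hST : S ≤ T := by
      intro v hv
      have hmem : (coordHom ρ μ).symm ψ ∈ homSub U μ := fun s => by
        rw [hψ]
        exact (hSle.trans inf_le_right) (φ.toLinearEquiv s).2
      have hv' : v = coordHom ρ μ ((coordHom ρ μ).symm ψ) (φ.toLinearEquiv.symm ⟨v, hv⟩) := by
        rw [hψ, LinearEquiv.apply_symm_apply]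
      rw [hv', coordHom_apply]
      exact Submodule.sum_mem T.toSubmodule fun l _ => T.toSubmodule.smul_mem _
        (Submodule.mem_iSup_of_mem μ (Submodule.mem_iSup_of_mem l ⟨_, hmem, rfl⟩))
    exact hS.1 (le_bot_iff.1 (hC.inf_eq_bot ▸ le_inf hST (hSle.trans inf_le_left)))
  intro u hu
  have hu' : u ∈ T.toSubmodule ⊔ C.toSubmodule := by
    rw [← Subrepresentation.toSubmodule_sup, hC.sup_eq_top]
    exact Submodule.mem_top
  obtain ⟨a, ha, c, hc, rfl⟩ := Submodule.mem_sup.1 hu'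
  have hcU : c ∈ C ⊓ U :=
    ⟨hc, by simpa using U.toSubmodule.sub_mem hu (hTU ha)⟩
  rw [hCU] at hcU
  have hc0 : c = 0 := hcU
  rw [hc0, add_zero]
  exact ha

-- The module `M` is generated by its own multiplicity spaces, and ∑ f_μ dim S_μ = dim M, so the
-- copies of the multiplicity spaces form a direct sum.
variable (ρ) in
theorem exists_isoProj : ∃ π : ∀ μ : IrrK K E, Fin (irrDim μ) →
    V →ₗ[K] (Fin (charMult ρ.character μ) → K),
    (∀ μ k a, π μ k (isoIncl ρ μ k a) = a) ∧
    ∀ μ k ν l a, (⟨μ, k⟩ : Σ μ : IrrK K E, Fin (irrDim μ)) ≠ ⟨ν, l⟩ →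
      π μ k (isoIncl ρ ν l a) = 0 := by
  refine exists_dual_projections (isoIncl ρ) (charMult ρ.character).support
    (fun μ => Finsupp.mem_support_iff.2) ?_ (sum_charMult_mul_irrDim ρ)
  have h := congrArg Subrepresentation.toSubmodule
    (ofMultiplicitySpaces_homSub (⊤ : Subrepresentation ρ))
  change _ = ⊤ at h
  rw [← h]
  exact iSup_mono fun μ => iSup_mono fun k => LinearMap.map_le_range

variable (ρ) in
/-- The projections from `M` to the multiplicity spaces. -/
noncomputable def isoProj : ∀ μ : IrrK K E, Fin (irrDim μ) →
    V →ₗ[K] (Fin (charMult ρ.character μ) → K) :=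
  (exists_isoProj ρ).choose

theorem isoProj_isoIncl (μ : IrrK K E) (k : Fin (irrDim μ))
    (a : Fin (charMult ρ.character μ) → K) : isoProj ρ μ k (isoIncl ρ μ k a) = a :=
  (exists_isoProj ρ).choose_spec.1 μ k a

theorem isoProj_isoIncl_of_ne {μ ν : IrrK K E} {k : Fin (irrDim μ)} {l : Fin (irrDim ν)}
    (h : (⟨μ, k⟩ : Σ μ : IrrK K E, Fin (irrDim μ)) ≠ ⟨ν, l⟩)
    (a : Fin (charMult ρ.character ν) → K) : isoProj ρ μ k (isoIncl ρ ν l a) = 0 :=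
  (exists_isoProj ρ).choose_spec.2 μ k ν l a h

theorem map_isoProj_ofMultiplicitySpaces
    (A : ∀ μ : IrrK K E, Submodule K (Fin (charMult ρ.character μ) → K)) (μ : IrrK K E)
    (k : Fin (irrDim μ)) : (ofMultiplicitySpaces A).toSubmodule.map (isoProj ρ μ k) = A μ := by
  apply le_antisymm
  · change Submodule.map _ (⨆ μ, ⨆ k, (A μ).map (isoIncl ρ μ k)) ≤ _
    simp only [Submodule.map_iSup]
    refine iSup_le fun ν => iSup_le fun l => ?_
    rintro _ ⟨_, ⟨a, ha, rfl⟩, rfl⟩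
    by_cases h : (⟨μ, k⟩ : Σ μ : IrrK K E, Fin (irrDim μ)) = ⟨ν, l⟩
    · cases h
      rw [isoProj_isoIncl]
      exact ha
    · rw [isoProj_isoIncl_of_ne h]
      exact (A μ).zero_mem
  · intro a ha
    exact ⟨isoIncl ρ μ k a, Submodule.mem_iSup_of_mem μ (Submodule.mem_iSup_of_mem k ⟨a, ha, rfl⟩),
      isoProj_isoIncl μ k a⟩

/-- The linear map does not depend on `U`. Hence multiplicities are ranks of a fixed map on `U`, and
regular frames of `U` yield regular frames of its multiplicity spaces. -/
theorem map_isoProj (U : Subrepresentation ρ) (μ : IrrK K E) (k : Fin (irrDim μ)) :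
    U.toSubmodule.map (isoProj ρ μ k) = homSub U μ := by
  have := map_isoProj_ofMultiplicitySpaces (homSub U) μ k
  rwa [ofMultiplicitySpaces_homSub] at this

theorem homSub_ofMultiplicitySpaces
    (A : ∀ μ : IrrK K E, Submodule K (Fin (charMult ρ.character μ) → K)) :
    homSub (ofMultiplicitySpaces A) = A := by
  funext μ
  rw [← map_isoProj _ μ ⟨0, irrDim_pos μ⟩, map_isoProj_ofMultiplicitySpaces]

theorem charMult_le (U : Subrepresentation ρ) (μ : IrrK K E) :
    charMult U.toRepresentation.character μ ≤ charMult ρ.character μ := by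
  rw [← finrank_homSub]
  exact (Submodule.finrank_le _).trans (finrank_fin_fun K).le

end Structure

/-! ### Regular frames on families of subspaces in the Plücker embedding. -/

namespace SpaceWithFunctions

open Filter Topology Module Representation

section Frames

variable {K V Y : Type*} [Field K] [AddCommGroup V] [Module K V] [FiniteDimensional K V] {t : ℕ}
  (j : Y → {U : Submodule K V // finrank K U = t})

/-- Locally on a family of subspaces embedded in projective space there are regular frames. -/
theorem exists_regular_frame (y : Y) :
    ∃ v : Fin t → ((projectiveSpace K (⋀[K]^t V)).induced fun y => pluckerPoint (j y)).carrier → V,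
      (∀ k, ((projectiveSpace K (⋀[K]^t V)).induced fun y => pluckerPoint (j y)).RegularVec
        (v k) y) ∧
      ∀ᶠ z : ((projectiveSpace K (⋀[K]^t V)).induced fun y => pluckerPoint (j y)).carrier in 𝓝 y,
        LinearIndependent K (fun k => v k z) ∧
        Submodule.span K (Set.range fun k => v k z) = (j z).1 := by
  obtain ⟨π, hπ⟩ := exists_pluckerDet_ne_zero (j y)
  refine ⟨fun k z => dualFrame π (pluckerPoint (j z)).rep k, fun k => RegularVec.comp
    (X := (projectiveSpace K (⋀[K]^t V)).induced fun y => pluckerPoint (j y))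
    (Y := projectiveSpace K (⋀[K]^t V)) isMorphism_induced
    (regularVec_projectiveSpace (cramerVec π k) (pluckerDet π) hπ), ?_⟩
  have h := eventually_ofForms_ne_zero (dual_mem_homogeneousForms (pluckerDet π))
    (x := pluckerPoint (j y)) hπ
  have h' := (continuous_induced (X := projectiveSpace K (⋀[K]^t V))
    (j := fun y => pluckerPoint (j y))).continuousAt.eventually h
  filter_upwards [h'] with z hz
  obtain ⟨h1, h2⟩ := dualFrame_spec (j z) π hz
  exact ⟨linearIndependent_of_dual π h1, h2⟩

/-- A map to a family of subspaces which locally has regular frames is a morphism. -/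
theorem isMorphism_of_frames {Z : SpaceWithFunctions K} (hZ : Z.IsGeometric) {φ : Z.carrier → Y}
    (h : ∀ z, ∃ v : Fin t → Z.carrier → V, (∀ k, Z.RegularVec (v k) z) ∧
      ∀ᶠ y in 𝓝 z, LinearIndependent K (fun k => v k y) ∧
        Submodule.span K (Set.range fun k => v k y) = (j (φ y)).1) :
    IsMorphism (X := Z)
      (Y := (projectiveSpace K (⋀[K]^t V)).induced fun y => pluckerPoint (j y)) φ := by
  refine isMorphism_induced_of_comp hZ (isMorphism_projectiveSpace hZ fun z => ?_)
  obtain ⟨v, hv, hφ⟩ := h z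
  exact ⟨_, RegularVec.multilinear hZ (exteriorPower.ιMulti K t).toMultilinearMap hv,
    hφ.mono fun y hy => rep_pluckerPoint (j (φ y)) hy.1 hy.2⟩

end Frames

end SpaceWithFunctions

/-- Selects members of a frame whose images are a basis of the image. The selection is by index, so
it can be kept fixed while the frame varies. -/
theorem exists_linearIndependent_comp {K V W : Type*} [Field K] [AddCommGroup V] [Module K V]
    [AddCommGroup W] [Module K W] {t m : ℕ} (w : Fin t → V) (L : V →ₗ[K] W)
    (hm : Module.finrank K ((Submodule.span K (Set.range w)).map L) = m) :
    ∃ r : Fin m → Fin t, LinearIndependent K fun k => L (w (r k)) := by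
  obtain ⟨κ, a, ha, hspan, hli⟩ := exists_linearIndependent' K (L ∘ w)
  have := Fintype.ofInjective a ha
  have hcard : Fintype.card κ = m := by
    rw [← finrank_span_eq_card hli, hspan, Set.range_comp, ← Submodule.map_span, hm]
  let e := Fintype.equivFinOfCardEq hcard
  exact ⟨a ∘ e.symm, hli.comp _ e.symm.injective⟩

/-! ### The loci Gr(η, M): closedness, product structure and irreducible components. -/

section CharGrassmannian

open Filter Topology Module Representation SpaceWithFunctions

section General

variable {K E V : Type*} [Field K] [Group E] [AddCommGroup V] [Module K V]
  {ρ : Representation K E V} {t : ℕ}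

theorem subrepPluckerPoint_injective [FiniteDimensional K V] :
    Function.Injective (subrepPluckerPoint (ρ := ρ) (t := t)) := fun _ _ h =>
  Subtype.ext (Subrepresentation.toSubmodule_injective
    (congrArg Subtype.val (pluckerPoint_injective h)))

theorem constituent_le {η : E → K} (hη : η ∈ constituents ρ.character t) :
    ∀ i : (charMult η).support, charMult η (i : IrrK K E) ≤ charMult ρ.character (i : IrrK K E) :=
  fun i => hη.1.2.2 i

variable [IsAlgClosed K] [CharZero K] [Finite E]

theorem charSum_charMult_of_isKCharacter {η : E → K} (hη : IsKCharacter K E η) :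
    charSum (charMult η) = η := by
  obtain ⟨n, τ, rfl⟩ := hη
  exact charSum_charMult τ

/-- Constituents are determined by their multiplicities, which are bounded by one finitely supported
function. -/
theorem finite_constituents : (constituents ρ.character t).Finite := by
  classical
  refine Set.Finite.of_finite_image (f := charMult)
    ((Set.finite_Iic (charMult ρ.character)).subset ?_) ?_
  · rintro _ ⟨η, hη, rfl⟩
    exact hη.1.2.2
  · intro η hη η' hη' h
    rw [← charSum_charMult_of_isKCharacter hη.1.1, h, charSum_charMult_of_isKCharacter hη'.1.1]

end General

variable {K E V : Type*} [Field K] [IsAlgClosed K] [CharZero K] [Group E] [Finite E]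
  [AddCommGroup V] [Module K V] [FiniteDimensional K V] {ρ : Representation K E V} {t : ℕ}

/-- The difference is a sum of irreducible characters of degree 0, while every irreducible character
has positive degree; characteristic zero excludes cancellation. -/
theorem eq_of_charMult_le {η η' : E → K} (hη : IsKCharacter K E η) (hη' : IsKCharacter K E η')
    (h1 : η 1 = η' 1) (hle : ∀ μ, charMult η' μ ≤ charMult η μ) : η' = η := by
  obtain ⟨d, hd⟩ : ∃ d, charMult η = charMult η' + d := exists_add_of_le hle
  have hsum := congrArg charSum hd
  rw [charSum_add, charSum_charMult_of_isKCharacter hη, charSum_charMult_of_isKCharacter hη'] at hsum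
  have h0 := congrFun hsum 1
  rw [Pi.add_apply, h1, left_eq_add, charSum_one, Nat.cast_eq_zero, Finset.sum_eq_zero_iff] at h0
  have hd0 : d = 0 := by
    ext μ
    by_contra hμ
    exact (mul_ne_zero hμ (irrDim_pos μ).ne') (h0 μ (Finsupp.mem_support_iff.2 hμ))
  rw [hsum, hd0, charSum, Finsupp.sum_zero_index, add_zero]

/-- The locus of submodules affording `η` is closed in the Grassmannian. -/
theorem isClosed_setOf_character {η : E → K} (hη : IsKCharacter K E η) (hη1 : η 1 = (t : K)) :
    IsClosed (X := (grassmannian K V t).carrier)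
      {U : {U : Submodule K V // finrank K U = t} |
        ∃ σ : Subrepresentation ρ, σ.toSubmodule = U.1 ∧ σ.toRepresentation.character = η} := by
  have hG : (grassmannian K V t).IsGeometric := isGeometric_projectiveSpace.induced
  refine isOpen_compl_iff.1 (isOpen_iff_mem_nhds.2 fun U hU => ?_)
  change {U : Submodule K V // finrank K U = t} at U
  obtain ⟨w, hw, hwU⟩ := exists_regular_frame (fun U : {U : Submodule K V // finrank K U = t} => U) U
  change ∀ k, (grassmannian K V t).RegularVec (w k) U at hw
  obtain ⟨hli, hspan⟩ := hwU.self_of_nhds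
  by_cases hinv : ∀ g k, ρ g (w k U) ∈ U.1
  · let σ : Subrepresentation ρ := ⟨U.1, fun g v hv => by
      have : U.1 ≤ U.1.comap (ρ g) := by
        conv_lhs => rw [← hspan]
        rw [Submodule.span_le]
        rintro _ ⟨k, rfl⟩
        exact hinv g k
      exact this hv⟩
    have hne : σ.toRepresentation.character ≠ η := fun h => hU ⟨σ, rfl, h⟩
    -- The degrees agree and the characters differ, so some multiplicity must exceed that of `η`.
    -- Being the rank of `L` on the subspace, it cannot drop nearby.
    obtain ⟨μ, hμ⟩ : ∃ μ, charMult η μ < charMult σ.toRepresentation.character μ := by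
      by_contra! h
      refine hne (eq_of_charMult_le hη (isKCharacter_character _) ?_ h)
      rw [hη1, char_one]
      exact congrArg Nat.cast U.2.symm
    let L := isoProj ρ μ ⟨0, irrDim_pos μ⟩
    have hfin : finrank K ((Submodule.span K (Set.range fun k => w k U)).map L) =
        charMult σ.toRepresentation.character μ := by
      rw [hspan, ← finrank_homSub, ← map_isoProj σ μ ⟨0, irrDim_pos μ⟩]
    obtain ⟨r, hr⟩ := exists_linearIndependent_comp (fun k => w k U) L hfin
    have hev := eventually_linearIndependent hG (v := fun k z => L (w (r k) z))
      (fun k => (hw (r k)).map L) hr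
    filter_upwards [hev, hwU] with U' hU' hwU'
    rintro ⟨σ', hσ', rfl⟩
    have hle : Submodule.span K (Set.range fun k => L (w (r k) U')) ≤ homSub σ' μ := by
      rw [← map_isoProj σ' μ ⟨0, irrDim_pos μ⟩, hσ', ← hwU'.2, Submodule.span_le]
      rintro _ ⟨k, rfl⟩
      exact ⟨_, Submodule.subset_span ⟨r k, rfl⟩, rfl⟩
    have h1 := Submodule.finrank_mono hle
    rw [finrank_span_eq_card hU', finrank_homSub, Fintype.card_fin] at h1
    omega
  · push Not at hinv
    obtain ⟨g, k, hgk⟩ := hinv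
    -- If `ρ g` moves a frame vector out of `U`, appending its image gives `t + 1` independent
    -- vectors. They remain independent nearby, so no nearby subspace is invariant.
    have hcons : ∀ m, (grassmannian K V t).RegularVec
        (fun z => (Fin.cons (ρ g (w k z)) (fun i => w i z) : Fin (t + 1) → V) m) U := by
      intro m
      refine Fin.cases ?_ (fun i => ?_) m
      · simpa only [Fin.cons_zero] using (hw k).map (ρ g)
      · simpa only [Fin.cons_succ] using hw i
    have hev := eventually_linearIndependent hG hcons
      (linearIndependent_finCons.2 ⟨hli, by rw [hspan]; exact hgk⟩)
    filter_upwards [hev, hwU] with U' hU' hwU'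
    rintro ⟨σ', hσ', -⟩
    refine (linearIndependent_finCons.1 hU').2 ?_
    rw [hwU'.2]
    change ρ g (w k U') ∈ U'.1
    rw [← hσ']
    refine σ'.apply_mem_toSubmodule g ?_
    rw [hσ']
    rw [← hwU'.2]
    exact Submodule.subset_span ⟨k, rfl⟩

theorem isClosed_image_charGrassmannian {η : E → K} (hη : IsKCharacter K E η)
    (hη1 : η 1 = (t : K)) :
    IsClosed (X := (projectiveSpace K (⋀[K]^t V)).carrier)
      (subrepPluckerPoint (ρ := ρ) (t := t) '' charGrassmannian ρ t η) := by
  have hind : IsInducing (X := (grassmannian K V t).carrier)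
      (Y := (projectiveSpace K (⋀[K]^t V)).carrier) pluckerPoint := ⟨rfl⟩
  have h := hind.isClosedMap isClosed_range_pluckerPoint _
    (isClosed_setOf_character (ρ := ρ) hη hη1)
  convert h using 1
  refine Set.Subset.antisymm ?_ ?_
  · rintro _ ⟨σ, hσ, rfl⟩
    exact ⟨⟨σ.1.toSubmodule, σ.2⟩, ⟨σ.1, rfl, hσ⟩, rfl⟩
  · rintro _ ⟨⟨U, hU⟩, ⟨σ, rfl, hσ⟩, rfl⟩
    exact ⟨⟨σ, hU⟩, hσ, rfl⟩

theorem isClosed_charGrassmannian {η : E → K} (hη : IsKCharacter K E η) (hη1 : η 1 = (t : K)) :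
    IsClosed (charGrassmannian ρ t η) := by
  have h := (isClosed_image_charGrassmannian (ρ := ρ) hη hη1).preimage
    (continuous_induced (X := projectiveSpace K (⋀[K]^t V))
      (j := subrepPluckerPoint (ρ := ρ) (t := t)))
  have h2 : subrepPluckerPoint ⁻¹' (subrepPluckerPoint '' charGrassmannian ρ t η) =
      charGrassmannian ρ t η := Set.preimage_image_eq _ subrepPluckerPoint_injective
  exact (congrArg (IsClosed (X := (invGrassmannian ρ t).carrier)) h2).mp h

theorem span_range_isoIncl {J : Finset (IrrK K E)} {e : J → ℕ}
    (A : ∀ μ : IrrK K E, Submodule K (Fin (charMult ρ.character μ) → K))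
    (hA : ∀ μ, μ ∉ J → A μ = ⊥)
    (b : ∀ i : J, Fin (e i) → Fin (charMult ρ.character (i : IrrK K E)) → K)
    (hb : ∀ i, Submodule.span K (Set.range fun k => b i k) = A i) :
    Submodule.span K (Set.range fun x : Σ i : J, Fin (irrDim (i : IrrK K E)) × Fin (e i) =>
      isoIncl ρ x.1 x.2.1 (b x.1 x.2.2)) = (ofMultiplicitySpaces A).toSubmodule := by
  apply le_antisymm
  · rw [Submodule.span_le]
    rintro _ ⟨⟨i, k, j⟩, rfl⟩
    refine Submodule.mem_iSup_of_mem _ (Submodule.mem_iSup_of_mem k ⟨_, ?_, rfl⟩)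
    exact (hb i).le (Submodule.subset_span ⟨j, rfl⟩)
  · refine iSup_le fun μ => iSup_le fun k => ?_
    by_cases h : μ ∈ J
    · refine (Submodule.map_mono (hb ⟨μ, h⟩).ge).trans ?_
      rw [Submodule.map_span, Submodule.span_le]
      rintro _ ⟨_, ⟨j, rfl⟩, rfl⟩
      exact Submodule.subset_span ⟨⟨⟨μ, h⟩, k, j⟩, rfl⟩
    · rw [hA μ h, Submodule.map_bot]
      exact bot_le

/-- `Gr(η, M)` is isomorphic to a product of Grassmannians. -/
theorem charGrassmannian_isomorphic {η : E → K} (hη : IsKCharacter K E η) (hη1 : η 1 = (t : K)) :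
    ((invGrassmannian ρ t).subspace (charGrassmannian ρ t η)).Isomorphic
      (prodGrassmannian K
        (fun μ : (charMult η).support => charMult η (μ : IrrK K E))
        (fun μ : (charMult η).support => charMult ρ.character (μ : IrrK K E))) := by
  classical
  set J := (charMult η).support with hJ
  let X := (invGrassmannian ρ t).subspace (charGrassmannian ρ t η)
  have hX : X.IsGeometric := isGeometric_projectiveSpace.induced.induced
  let G : J → Type _ := fun i =>
    {U : Submodule K (Fin (charMult ρ.character (i : IrrK K E)) → K) //
      finrank K U = charMult η (i : IrrK K E)}
  -- The product runs over the support of `η` only; outside it the multiplicity is 0, which forces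
  -- the zero subspace.
  let ext : (∀ i, G i) → ∀ μ : IrrK K E, Submodule K (Fin (charMult ρ.character μ) → K) :=
    fun A μ => if h : μ ∈ J then (A ⟨μ, h⟩).1 else ⊥
  have hext : ∀ A (i : J), ext A i = (A i).1 := fun A i => dif_pos i.2
  have hext0 : ∀ A μ, μ ∉ J → ext A μ = ⊥ := fun A μ h => dif_neg h
  have hmult : ∀ A, charMult (ofMultiplicitySpaces (ext A)).toRepresentation.character =
      charMult η := by
    intro A
    ext μ
    rw [← finrank_homSub, homSub_ofMultiplicitySpaces]
    by_cases h : μ ∈ J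
    · rw [hext A ⟨μ, h⟩]
      exact (A ⟨μ, h⟩).2
    · rw [hext0 A μ h, finrank_bot, Finsupp.notMem_support_iff.1 h]
  have hchar : ∀ A, (ofMultiplicitySpaces (ext A)).toRepresentation.character = η := by
    intro A
    rw [← charSum_charMult, hmult, charSum_charMult_of_isKCharacter hη]
  have hfin : ∀ A, finrank K (ofMultiplicitySpaces (ext A)).toSubmodule = t := by
    intro A
    have h := congrFun (hchar A) 1
    rw [hη1, char_one] at h
    exact_mod_cast h
  let toFun : charGrassmannian ρ t η → ∀ i, G i := fun σ i =>
    ⟨homSub σ.1.1 i, by rw [finrank_homSub, σ.2]⟩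
  let φ : charGrassmannian ρ t η ≃ ∀ i, G i :=
    { toFun := toFun
      invFun := fun A => ⟨⟨ofMultiplicitySpaces (ext A), hfin A⟩, hchar A⟩
      left_inv := by
        intro σ
        refine Subtype.ext (Subtype.ext ?_)
        refine Eq.trans (congrArg ofMultiplicitySpaces (funext fun μ => ?_))
          (ofMultiplicitySpaces_homSub σ.1.1)
        by_cases h : μ ∈ J
        · exact hext (toFun σ) ⟨μ, h⟩
        · refine (hext0 (toFun σ) μ h).trans (Submodule.finrank_eq_zero.1 ?_).symm
          rw [finrank_homSub, σ.2, Finsupp.notMem_support_iff.1 h]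
      right_inv := by
        intro A
        funext i
        refine Subtype.ext ?_
        change homSub (ofMultiplicitySpaces (ext A)) i = _
        rw [homSub_ofMultiplicitySpaces, hext] }
  refine ⟨φ, ?_, ?_⟩
  · refine isMorphism_prodGrassmannian hX fun σ i => ?_
    obtain ⟨w, hw, hwU⟩ := exists_regular_frame
      (fun σ : {σ : Subrepresentation ρ // finrank K σ.toSubmodule = t} =>
        (⟨σ.1.toSubmodule, σ.2⟩ : {U : Submodule K V // finrank K U = t})) σ.1
    let k₀ : Fin (irrDim (i : IrrK K E)) := ⟨0, irrDim_pos _⟩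
    let L := isoProj ρ (i : IrrK K E) k₀
    have hw' : ∀ k, X.RegularVec (fun y => w k y.1) σ := fun k =>
      RegularVec.comp (X := X) (Y := invGrassmannian ρ t) isMorphism_induced (hw k)
    have hwU' := (continuous_induced (X := invGrassmannian ρ t)
      (j := (Subtype.val : charGrassmannian ρ t η → _))).continuousAt (x := σ) |>.eventually hwU
    have hfinr : finrank K ((Submodule.span K (Set.range fun k => w k σ.1)).map L) =
        charMult η (i : IrrK K E) := by
      rw [hwU'.self_of_nhds.2]
      change finrank K (σ.1.1.toSubmodule.map (isoProj ρ i k₀)) = _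
      rw [map_isoProj, finrank_homSub, σ.2]
    obtain ⟨r, hr⟩ := exists_linearIndependent_comp (fun k => w k σ.1) L hfinr
    -- Frame vectors selected at `σ` project into the multiplicity space; near `σ` they stay
    -- independent, and since the dimension is constant on Gr(η, M) they still span.
    refine ⟨fun k y => L (w (r k) y.1), fun k => (hw' (r k)).map L, ?_⟩
    filter_upwards [eventually_linearIndependent hX (v := fun k y => L (w (r k) y.1))
      (fun k => (hw' (r k)).map L) hr, hwU'] with y hy hyU
    refine ⟨hy, span_range_eq_of_finrank (φ y i).2 hy fun k => ?_⟩
    change _ ∈ homSub y.1.1 i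
    rw [← map_isoProj y.1.1 i k₀]
    refine ⟨_, ?_, rfl⟩
    change _ ∈ y.1.1.toSubmodule
    rw [← hyU.2]
    exact Submodule.subset_span ⟨r k, rfl⟩
  · have hY := isGeometric_prodGrassmannian (K := K)
      (e := fun μ : J => charMult η (μ : IrrK K E))
      (f := fun μ : J => charMult ρ.character (μ : IrrK K E))
    refine isMorphism_induced_of_comp hY (isMorphism_of_frames
      (fun σ : {σ : Subrepresentation ρ // finrank K σ.toSubmodule = t} =>
        (⟨σ.1.toSubmodule, σ.2⟩ : {U : Submodule K V // finrank K U = t})) hY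
      (φ := fun A => (φ.symm A).1) fun A => ?_)
    choose v hv hvA using exists_regular_frame_prodGrassmannian (K := K)
      (e := fun μ : J => charMult η (μ : IrrK K E))
      (f := fun μ : J => charMult ρ.character (μ : IrrK K E)) A
    -- The frame of the submodule consists of one copy of each multiplicity frame for every basis
    -- vector of S_μ, so its size is the degree of `η`.
    have hcard : Fintype.card (Σ i : J, Fin (irrDim (i : IrrK K E)) ×
        Fin (charMult η (i : IrrK K E))) = t := by
      have h := charSum_one (charMult η)
      rw [charSum_charMult_of_isKCharacter hη, hη1, Nat.cast_inj] at h
      rw [h, Fintype.card_sigma, ← Finset.sum_coe_sort (charMult η).support fun μ =>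
        charMult η μ * irrDim μ]
      refine Finset.sum_congr rfl fun i _ => ?_
      rw [Fintype.card_prod, Fintype.card_fin, Fintype.card_fin, mul_comm]
    let ε := (Fintype.equivFinOfCardEq hcard).symm
    refine ⟨fun m y => isoIncl ρ (ε m).1 (ε m).2.1 (v (ε m).1 (ε m).2.2 y),
      fun m => (hv _ _).map _, ?_⟩
    filter_upwards [eventually_all.2 hvA] with y hy
    change ∀ i, G i at y
    have hspan := span_range_isoIncl (ρ := ρ) (ext y) (hext0 y) (fun i k => v i k y)
      fun i => (hy i).2.trans (hext y i).symm
    rw [← ε.surjective.range_comp] at hspan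
    refine ⟨?_, hspan⟩
    -- Independence comes from counting: `t` vectors span a space of dimension `t`.
    refine linearIndependent_iff_card_eq_finrank_span.2 ?_
    exact (Fintype.card_fin t).trans
      ((hfin y).symm.trans (congrArg (fun W : Submodule K V => finrank K W) hspan.symm))

theorem isIrreducible_charGrassmannian {η : E → K} (hη : η ∈ constituents ρ.character t) :
    IsIrreducible (charGrassmannian ρ t η) := by
  obtain ⟨h⟩ := (charGrassmannian_isomorphic (ρ := ρ) hη.1.1 hη.2).nonempty_homeomorph
  have := irreducibleSpace_prodGrassmannian (K := K) (constituent_le hη)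
  have h1 : IsIrreducible (X := ((invGrassmannian ρ t).subspace (charGrassmannian ρ t η)).carrier)
      Set.univ := by
    rw [← Set.image_univ_of_surjective h.symm.surjective]
    exact (IrreducibleSpace.isIrreducible_univ _).image _ h.symm.continuous.continuousOn
  have h2 := h1.image Subtype.val (continuous_induced (X := invGrassmannian ρ t)
    (j := (Subtype.val : charGrassmannian ρ t η → _))).continuousOn
  have h3 : Subtype.val '' (Set.univ : Set (charGrassmannian ρ t η)) = charGrassmannian ρ t η := by
    rw [Set.image_univ, Subtype.range_coe]
  exact h3 ▸ h2

/-- Since `η` is a constituent, the difference of functions is again a sum of irreducible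
characters, and the truncated subtraction of multiplicities is exact. -/
theorem charInner_sub {η : E → K} (hη : η ∈ constituents ρ.character t) :
    charInner η (ρ.character - η) = ∑ i : (charMult η).support, charMult η (i : IrrK K E) *
      (charMult ρ.character (i : IrrK K E) - charMult η (i : IrrK K E)) := by
  have hle : charMult η ≤ charMult ρ.character := hη.1.2.2
  have hsub : ρ.character - η = charSum (charMult ρ.character - charMult η) := by
    have h := charSum_add (charMult ρ.character - charMult η) (charMult η)
    rw [tsub_add_cancel_of_le hle, charSum_charMult, charSum_charMult_of_isKCharacter hη.1.1] at h
    exact sub_eq_of_eq_add h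
  rw [charInner, hsub, charMult_charSum, Finsupp.sum]
  exact (Finset.sum_coe_sort (charMult η).support fun μ =>
    charMult η μ * (charMult ρ.character μ - charMult η μ)).symm

theorem character_mem_constituents
    (σ : {σ : Subrepresentation ρ // finrank K σ.toSubmodule = t}) :
    σ.1.toRepresentation.character ∈ constituents ρ.character t := by
  refine ⟨⟨isKCharacter_character _, isKCharacter_character _, charMult_le σ.1⟩, ?_⟩
  rw [char_one]
  exact congrArg Nat.cast σ.2

theorem eq_of_charGrassmannian_subset {η η' : E → K} (hη : η ∈ constituents ρ.character t)
    (h : charGrassmannian ρ t η ⊆ charGrassmannian ρ t η') : η = η' := by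
  obtain ⟨σ, hσ⟩ := (isIrreducible_charGrassmannian hη).nonempty
  exact (show _ = η from hσ).symm.trans (h hσ)

/-- Finitely many closed sets Gr(η, M) cover the space, so each irreducible set lies in one of them;
they are irreducible, and none contains another because a submodule has only one character. -/
theorem irreducibleComponents_invGrassmannian :
    irreducibleComponents (invGrassmannian ρ t).carrier =
      charGrassmannian ρ t '' constituents ρ.character t := by
  have key : ∀ T : Set (invGrassmannian ρ t).carrier, IsIrreducible T →
      ∃ η ∈ constituents ρ.character t, T ⊆ charGrassmannian ρ t η := by
    intro T hT
    have hfin := (finite_constituents (ρ := ρ) (t := t)).image (charGrassmannian ρ t)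
    obtain ⟨Z, hZ, hTZ⟩ := isIrreducible_iff_sUnion_isClosed.1 hT hfin.toFinset
      (by
        intro Z hZ
        obtain ⟨η, hη, rfl⟩ := hfin.mem_toFinset.1 hZ
        exact isClosed_charGrassmannian hη.1.1 hη.2)
      (fun σ _ => ⟨_, hfin.mem_toFinset.2 ⟨_, character_mem_constituents σ, rfl⟩, rfl⟩)
    obtain ⟨η, hη, rfl⟩ := hfin.mem_toFinset.1 hZ
    exact ⟨η, hη, hTZ⟩
  refine Set.Subset.antisymm ?_ ?_
  · intro T hT
    obtain ⟨η, hη, hTη⟩ := key T hT.1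
    exact ⟨η, hη, (hT.2 (isIrreducible_charGrassmannian hη) hTη).antisymm hTη⟩
  · rintro _ ⟨η, hη, rfl⟩
    refine ⟨isIrreducible_charGrassmannian hη, fun T hT hle => ?_⟩
    obtain ⟨η', hη', hTη⟩ := key T hT
    rw [eq_of_charGrassmannian_subset hη (hle.trans hTη)]
    exact hTη

end CharGrassmannian

theorem mainTheorem2 {K E V : Type*} [Field K] [IsAlgClosed K] [CharZero K] [Group E] [Finite E]
    [AddCommGroup V] [Module K V] [FiniteDimensional K V] (ρ : Representation K E V)
    (t : ℕ) (ht : 1 ≤ t) (htV : t ≤ Module.finrank K V) :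
    (∀ η ∈ constituents ρ.character t,
      IsClosed (charGrassmannian ρ t η) ∧
      IsClosed (X := (projectiveSpace K (⋀[K]^t V)).carrier)
        (subrepPluckerPoint (ρ := ρ) (t := t) '' charGrassmannian ρ t η) ∧
      IsIrreducible (charGrassmannian ρ t η) ∧
      ((invGrassmannian ρ t).subspace (charGrassmannian ρ t η)).Isomorphic
        (prodGrassmannian K
          (fun μ : (charMult η).support => charMult η (μ : IrrK K E))
          (fun μ : (charMult η).support => charMult ρ.character (μ : IrrK K E))) ∧
      IsRational ((invGrassmannian ρ t).subspace (charGrassmannian ρ t η)) ∧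
      topologicalKrullDim ((invGrassmannian ρ t).subspace (charGrassmannian ρ t η)).carrier =
        (charInner η (ρ.character - η) : ℕ)) ∧
    irreducibleComponents (invGrassmannian ρ t).carrier =
      charGrassmannian ρ t '' constituents ρ.character t ∧
    Set.InjOn (charGrassmannian ρ t) (constituents ρ.character t) := by
  refine ⟨fun η hη => ?_, irreducibleComponents_invGrassmannian,
    fun η hη η' _ h => eq_of_charGrassmannian_subset hη h.subset⟩
  have hiso := charGrassmannian_isomorphic (ρ := ρ) hη.1.1 hη.2
  refine ⟨isClosed_charGrassmannian hη.1.1 hη.2, isClosed_image_charGrassmannian hη.1.1 hη.2,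
    isIrreducible_charGrassmannian hη, hiso, ?_, ?_⟩
  · exact hiso.symm.isRational SpaceWithFunctions.isGeometric_prodGrassmannian
      SpaceWithFunctions.isGeometric_projectiveSpace.induced.induced
      (SpaceWithFunctions.isRational_prodGrassmannian (constituent_le hη))
  · obtain ⟨h⟩ := hiso.nonempty_homeomorph
    rw [IsHomeomorph.topologicalKrullDim_eq _ h.isHomeomorph,
      SpaceWithFunctions.topologicalKrullDim_prodGrassmannian (constituent_le hη),
      charInner_sub hη]
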